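/- All functions are Lebesgue measurable functions on $(0,\infty)$ with values in $[0,\infty]$; functions that agree a.e. are not distinguished, and $0\cdot\infty=0$, $1/\infty=0$. For $0<p\le\infty$ and an interval $I$ let $\|f\|_{p,I}$ be the $L_p(I)$ (quasi-)norm and $\|f\|_{p,w,I}=\|fw\|_{p,I}$; $L_p(w)=\{f:\|f\|_{p,w,(0,\infty)}<\infty\}$. A weight is a function that is positive and finite a.e. Put $$\|f\|_{\mathrm{Ces}_{p,q}(u,v)}=\big\|\,\|f\|_{p,v,(0,\cdot)}\big\|_{q,u,(0,\infty)},\qquad \|f\|_{\mathrm{Cop}_{r}(u)}=\Big\|\int_{\cdot}^{\infty}f\Big\|_{r,u,(0,\infty)},$$ and let $\mathrm{Ces}_{p,q}(u,v)$, $\mathrm{Cop}_r(u)$ be the sets of functions for which these are finite. Let $M(X,Y)=\{f: fg\in Y\text{ for all }g\in X\}$ with $\|f\|_{M(X,Y)}=\sup\{\|fg\|_Y/\|g\|_X : g\in X,\ g\not\sim0\}$, where $g\not\sim 0$ means that $g$ does not vanish a.e. Let $p'=p/(1-p)$ for $0<p<1$ and $1'=\infty$; for $p<r$ let $r\to p$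 be given by $\frac1{r\to p}=\frac1p-\frac1r$. For $0<p,q<\infty$ put $$A_{q,p}(u)(x)=\Big(\int_0^xu^q\Big)^{-1/p}u(x)^{(q-p)/p},\qquad A^*_{q,p}(u)(x)=\Big(\int_x^\infty u^q\Big)^{1/p}u(x)^{(p-q)/p}.$$ "$X=Y$" for two spaces means that they contain the same functions and that their quasi-norms are equivalent; an intersection carries the sum of the two quasi-norms. **Theorem.** Let $0<p,q,r<\infty$, $r\ne1$ and $p=q\le1$. Let $v$ be a weight on $(0,\infty)$, let $u$ satisfy $0<\|u\|_{r,(0,t)}<\infty$ for all $t>0$, and let $w$ satisfy $0<\|w\|_{q,(t,\infty)}<\infty$ for all $t>0$. Put $\omega_2=A^*_{p,p}(w)\,v$. (i) If $r\le p$ and $\omega_1=A_{r,r}(u)$, then $$M(\mathrm{Cop}_r(u),\mathrm{Ces}_{p,q}(w,v))=\mathrm{Ces}_{p',\infty}(\omega_1,\omega_2),$$ and $\|f\|_{M(\mathrm{Cop}_r(u),\mathrm{Ces}_{p,q}(w,v))}\approx\|f\|_{\mathrm{Ces}_{p',\infty}(\omega_1,\omega_2)}$. (ii) If $p<r$ and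 $\omega_1=A_{r,p}(u)$, then $$M(\mathrm{Cop}_r(u),\mathrm{Ces}_{p,q}(w,v))=\begin{cases}\mathrm{Ces}_{p',r\to p}(\omega_1,\omega_2)\cap L_{p'}(\omega_2)&\text{if }\|u\|_{r,(0,\infty)}<\infty,\\ \mathrm{Ces}_{p',r\to p}(\omega_1,\omega_2)&\text{if }\|u\|_{r,(0,\infty)}=\infty,\end{cases}$$ and $$\|f\|_{M(\mathrm{Cop}_r(u),\mathrm{Ces}_{p,q}(w,v))}\approx\|f\|_{\mathrm{Ces}_{p',r\to p}(\omega_1,\omega_2)}+\|u\|_{r,(0,\infty)}^{-1}\,\|f\|_{p',\omega_2,(0,\infty)}.$$ In both formulas $\approx$ holds for all measurable $f\ge 0$ (both sides may be infinite), with constants that depend only on $p$ and $r$. -/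

import Mathlib

open MeasureTheory Set
open scoped ENNReal NNReal

noncomputable section

namespace CopCes

/-- Lebesgue measure on the half-line `(0, ∞)`. -/
def halfLine : Measure ℝ := volume.restrict (Ioi 0)

/-- Lebesgue measurable functions on `(0, ∞)` with values in `[0, ∞]` (only the restriction to
`(0, ∞)` of the function `f` is relevant). Products use the convention `0 * ∞ = 0`. -/
def MeasPos : Set (ℝ → ℝ≥0∞) := {f | AEMeasurable f halfLine}

/-- Weights on `(0, ∞)`: measurable, positive and finite almost everywhere. -/
def Weight : Set (ℝ → ℝ≥0∞) :=
  {v | v ∈ MeasPos ∧ ∀ᵐ x ∂halfLine, 0 < v x ∧ v x < ∞}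

/-- The weighted functional `‖f‖_{p,w,I} = ‖f w‖_{L_p(I)}`, `0 < p ≤ ∞`. -/
def wnorm (p : ℝ≥0∞) (w : ℝ → ℝ≥0∞) (I : Set ℝ) (f : ℝ → ℝ≥0∞) : ℝ≥0∞ :=
  eLpNorm (fun x => f x * w x) p (volume.restrict I)

/-- The unweighted functional `‖f‖_{p,I}`. -/
def lnorm (p : ℝ≥0∞) (I : Set ℝ) (f : ℝ → ℝ≥0∞) : ℝ≥0∞ :=
  eLpNorm f p (volume.restrict I)

/-- The exponent `p'`, which is `p / (1 - p)` for `0 < p < 1` and the usual Hölder conjugate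
for `1 ≤ p ≤ ∞`. -/
def conjExp (p : ℝ≥0∞) : ℝ≥0∞ :=
  if p < 1 then p / (1 - p)
  else if p = 1 then ∞
  else if p = ∞ then 1
  else p / (p - 1)

/-- The exponent `p → q`: `1 / (p → q) = 1 / q - 1 / p` if `q < p`, and `∞` if `p ≤ q`. -/
def arrow (p q : ℝ≥0∞) : ℝ≥0∞ :=
  if q < p then (q⁻¹ - p⁻¹)⁻¹ else ∞

/-- `Ω_q`: functions `u` with `0 < ‖u‖_{q,(t,∞)} < ∞` for all `t > 0`. -/
def Omega (q : ℝ≥0∞) : Set (ℝ → ℝ≥0∞) :=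
  {u | u ∈ MeasPos ∧ ∀ t : ℝ, 0 < t → 0 < lnorm q (Ioi t) u ∧ lnorm q (Ioi t) u < ∞}

/-- The dual class of `Ω_q`: functions `u` with `0 < ‖u‖_{q,(0,t)} < ∞` for all `t > 0`. -/
def DualOmega (q : ℝ≥0∞) : Set (ℝ → ℝ≥0∞) :=
  {u | u ∈ MeasPos ∧ ∀ t : ℝ, 0 < t → 0 < lnorm q (Ioo 0 t) u ∧ lnorm q (Ioo 0 t) u < ∞}

/-- `A_{q,p}(u)(x) = (∫₀ˣ u^q)^{-1/p} u(x)^{(q-p)/p}`, for finite `p` and `q`. -/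
def opA (q p : ℝ≥0∞) (u : ℝ → ℝ≥0∞) (x : ℝ) : ℝ≥0∞ :=
  (∫⁻ t in Ioo 0 x, u t ^ q.toReal) ^ (-(1 / p.toReal)) *
    u x ^ ((q.toReal - p.toReal) / p.toReal)

/-- `A*_{q,p}(u)(x) = (∫ₓ^∞ u^q)^{1/p} u(x)^{(p-q)/p}`, for finite `p` and `q`. -/
def opAStar (q p : ℝ≥0∞) (u : ℝ → ℝ≥0∞) (x : ℝ) : ℝ≥0∞ :=
  (∫⁻ t in Ioi x, u t ^ q.toReal) ^ (1 / p.toReal) *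
    u x ^ ((p.toReal - q.toReal) / p.toReal)

/-- A space of non-negative measurable functions on `(0, ∞)` together with its functional. -/
structure FunSpace where
  carrier : Set (ℝ → ℝ≥0∞)
  qnorm : (ℝ → ℝ≥0∞) → ℝ≥0∞

/-- The space of all measurable functions on which a given functional is finite. -/
def FunSpace.ofNorm (N : (ℝ → ℝ≥0∞) → ℝ≥0∞) : FunSpace where
  carrier := {f | f ∈ MeasPos ∧ N f < ∞}
  qnorm := N

/-- Intersection of two spaces, with the sum of the two functionals. -/
def FunSpace.inter (X Y : FunSpace) : FunSpace where
  carrier := X.carrier ∩ Y.carrier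
  qnorm f := X.qnorm f + Y.qnorm f

/-- `X = Y` in the algebraic and the topological sense: the same functions, and equivalent
quasi-norms. -/
def FunSpace.Same (X Y : FunSpace) : Prop :=
  X.carrier = Y.carrier ∧
    ∃ C : ℝ≥0, ∀ f ∈ X.carrier, X.qnorm f ≤ C * Y.qnorm f ∧ Y.qnorm f ≤ C * X.qnorm f

/-- The weighted Lebesgue space `L_p(w)` on `(0, ∞)`. -/
def Lp (p : ℝ≥0∞) (w : ℝ → ℝ≥0∞) : FunSpace :=
  .ofNorm (wnorm p w (Ioi 0))

/-- The weighted Cesàro space `Ces_{p,q}(u,v)`. -/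
def Ces (p q : ℝ≥0∞) (u v : ℝ → ℝ≥0∞) : FunSpace :=
  .ofNorm fun f => wnorm q u (Ioi 0) fun t => wnorm p v (Ioo 0 t) f

/-- The weighted Copson space `Cop_{p,q}(u,v)`. -/
def Cop (p q : ℝ≥0∞) (u v : ℝ → ℝ≥0∞) : FunSpace :=
  .ofNorm fun f => wnorm q u (Ioi 0) fun t => wnorm p v (Ioi t) f

/-- `Cop_r(u) = Cop_{1,r}(u, 1)`. -/
def CopOne (r : ℝ≥0∞) (u : ℝ → ℝ≥0∞) : FunSpace := Cop 1 r u fun _ => 1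

/-- The space `M(X, Y)` of pointwise multipliers from `X` to `Y`, with
`‖f‖_{M(X,Y)} = sup ‖f g‖_Y / ‖g‖_X` over all `g ∈ X` that do not vanish almost everywhere. -/
def Mult (X Y : FunSpace) : FunSpace where
  carrier := {f | f ∈ MeasPos ∧ ∀ g ∈ X.carrier, (fun x => f x * g x) ∈ Y.carrier}
  qnorm f := ⨆ g ∈ {g | g ∈ X.carrier ∧ ¬ g =ᵐ[halfLine] fun _ => 0},
    Y.qnorm (fun x => f x * g x) / X.qnorm g

end CopCes

end

/-! ### Dyadic level sets of the primitive of a density -/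

noncomputable section

namespace CopCes

/-! Because `p = q`, Tonelli's theorem turns the target Cesàro norm into the `L_p` norm with weight
`ω₂` (`ces_self_qnorm`). With `F = f ω₂` and `ρ = u^r`, the multiplier norm is therefore the best
`M` in `‖F g‖_p ≤ M (∫ (∫ₓ^∞ g)^r ρ)^(1/r)`.

Cut the half-line into levels on which `∫₀ˣ ρ` lies between `2^k` and `2^(k+1)`. By a discrete Hardy
inequality the Copson norm is equivalent to the `ℓ^r` norm of `2^(k/r) ∫ g` over level `k`
(`IsDensity.copSum_le`, `exists_copInt_le`). On a single level, the norm of multiplication by `F`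
from `L_1` to `L_p` is `‖F‖_{p'}`, by Hölder and near-extremal functions (`lintegral_mul_rpow_le`,
`exists_near_extremal`). What remains is a diagonal multiplier from `ℓ^r` to `ℓ^p` with entries
`2^(-k/r) ‖F‖_{p', level k}`. Its norm is the `ℓ^∞` norm of the entries if `r ≤ p`, and their
`ℓ^(r→p)` norm if `p < r` (`multInt_le_of_le`, `multInt_le_cesSum_mul`, `exists_conjNorm_level_le`,
`exists_cesSum_le`).

Finally levels are replaced by the intervals `(0,t)`, using geometric decay or Hardy's inequality
for heads (`exists_conjNorm_Ioo_le`, `cesSum_le`, `exists_le_cesSum`). If `∫ ρ` is finite, the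
topmost levels have no full level to their right, and the integral over `t` cannot control them;
this produces the extra `L_{p'}` term. Every constant comes from a discrete inequality, so it
depends only on `p` and `r`. That each multiplier has finite norm is a gliding hump argument
(`mult_carrier_eq`). -/

/-- The primitive `t ↦ ∫₀ᵗ ρ` of a non-negative density. -/
def prim (ρ : ℝ → ℝ≥0∞) (t : ℝ) : ℝ≥0∞ := ∫⁻ x in Ioo 0 t, ρ x

/-- The total mass `∫₀^∞ ρ`. -/
def totalMass (ρ : ℝ → ℝ≥0∞) : ℝ≥0∞ := ∫⁻ x in Ioi (0 : ℝ), ρ x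

/-- A density on the half-line whose primitive is positive and finite. -/
structure IsDensity (ρ : ℝ → ℝ≥0∞) : Prop where
  aemeasurable : AEMeasurable ρ halfLine
  pos : ∀ t, 0 < t → 0 < prim ρ t
  lt_top : ∀ t, 0 < t → prim ρ t < ∞

/-- The dyadic level set `{x > 0 : 2 ^ k ≤ ∫₀ˣ ρ < 2 ^ (k + 1)}`. -/
def level (ρ : ℝ → ℝ≥0∞) (k : ℤ) : Set ℝ :=
  {x | 0 < x ∧ (2 : ℝ≥0∞) ^ (k : ℝ) ≤ prim ρ x ∧ prim ρ x < (2 : ℝ≥0∞) ^ ((k : ℝ) + 1)}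

variable {ρ : ℝ → ℝ≥0∞}

lemma prim_mono (ρ : ℝ → ℝ≥0∞) : Monotone (prim ρ) := fun _ _ h =>
  lintegral_mono_set (Ioo_subset_Ioo_right h)

lemma prim_le_totalMass (ρ : ℝ → ℝ≥0∞) (t : ℝ) : prim ρ t ≤ totalMass ρ :=
  lintegral_mono_set fun _ h => h.1

lemma two_rpow_pos (a : ℝ) : (2 : ℝ≥0∞) ^ a ≠ 0 := by
  simp [ENNReal.rpow_eq_zero_iff]

lemma two_rpow_ne_top (a : ℝ) : (2 : ℝ≥0∞) ^ a ≠ ∞ := by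
  simp [ENNReal.rpow_eq_top_iff]

lemma two_rpow_add (a b : ℝ) : (2 : ℝ≥0∞) ^ (a + b) = 2 ^ a * 2 ^ b :=
  ENNReal.rpow_add _ _ (by simp) (by simp)

lemma two_rpow_mono {a b : ℝ} (h : a ≤ b) : (2 : ℝ≥0∞) ^ a ≤ 2 ^ b :=
  ENNReal.rpow_le_rpow_of_exponent_le (by norm_num) h

lemma exists_two_rpow_le_lt {c : ℝ≥0∞} (h0 : c ≠ 0) (ht : c ≠ ∞) :
    ∃ k : ℤ, (2 : ℝ≥0∞) ^ (k : ℝ) ≤ c ∧ c < (2 : ℝ≥0∞) ^ ((k : ℝ) + 1) := by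
  obtain ⟨k, h1, h2⟩ := ENNReal.exists_mem_Ico_zpow h0 ht (y := 2) (by norm_num) (by norm_num)
  refine ⟨k, by rwa [ENNReal.rpow_intCast], ?_⟩
  have : ((k : ℝ) + 1) = ((k + 1 : ℤ) : ℝ) := by push_cast; ring
  rwa [this, ENNReal.rpow_intCast]

lemma level_subset (ρ : ℝ → ℝ≥0∞) (k : ℤ) : level ρ k ⊆ Ioi 0 := fun _ h => h.1

lemma measurableSet_level (ρ : ℝ → ℝ≥0∞) (k : ℤ) : MeasurableSet (level ρ k) :=
  measurableSet_Ioi.inter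
    ((measurableSet_le measurable_const (prim_mono ρ).measurable).inter
      (measurableSet_lt (prim_mono ρ).measurable measurable_const))

lemma lt_of_mem_level {j k : ℤ} (hjk : j < k) {x y : ℝ} (hx : x ∈ level ρ j)
    (hy : y ∈ level ρ k) : x < y := by
  by_contra! h
  have h1 : (j : ℝ) + 1 ≤ k := by exact_mod_cast hjk
  exact absurd ((hy.2.1.trans (prim_mono ρ h)).trans_lt hx.2.2) (not_lt.2 (two_rpow_mono h1))

lemma pairwise_disjoint_level (ρ : ℝ → ℝ≥0∞) :
    Pairwise (Function.onFun Disjoint (level ρ)) := by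
  intro j k hjk
  refine Set.disjoint_left.2 fun x hx hy => ?_
  rcases lt_or_gt_of_ne hjk with h | h
  · exact lt_irrefl _ (lt_of_mem_level h hx hy)
  · exact lt_irrefl _ (lt_of_mem_level h hy hx)

lemma iUnion_level (h : IsDensity ρ) : ⋃ k, level ρ k = Ioi 0 := by
  refine Subset.antisymm (iUnion_subset (level_subset ρ)) fun x hx => ?_
  obtain ⟨k, h1, h2⟩ := exists_two_rpow_le_lt (h.pos x hx).ne' (h.lt_top x hx).ne
  exact mem_iUnion.2 ⟨k, hx, h1, h2⟩

lemma lintegral_eq_tsum_level (h : IsDensity ρ) (f : ℝ → ℝ≥0∞) :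
    ∫⁻ x in Ioi (0 : ℝ), f x = ∑' k, ∫⁻ x in level ρ k, f x := by
  rw [← iUnion_level h, lintegral_iUnion (measurableSet_level ρ) (pairwise_disjoint_level ρ)]

lemma IsDensity.lintegral_Ioc_eq (t : ℝ) : ∫⁻ x in Ioc 0 t, ρ x = prim ρ t :=
  setLIntegral_congr Ioo_ae_eq_Ioc.symm

lemma IsDensity.toReal_prim (h : IsDensity ρ) {b t : ℝ} (hb : 0 < b) (ht : t ∈ Icc 0 b) :
    ∫ x in Ioc 0 t, (ρ x).toReal = (prim ρ t).toReal := by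
  have hle : volume.restrict (Ioc 0 t) ≤ halfLine :=
    Measure.restrict_mono (fun x hx => hx.1) le_rfl
  rw [integral_toReal (h.aemeasurable.mono_measure hle), lintegral_Ioc_eq]
  refine ae_lt_top' (h.aemeasurable.mono_measure hle) ?_
  rw [lintegral_Ioc_eq]
  exact ((prim_mono ρ ht.2).trans_lt (h.lt_top b hb)).ne

lemma IsDensity.continuousOn (h : IsDensity ρ) {b : ℝ} (hb : 0 < b) :
    ContinuousOn (fun t => (prim ρ t).toReal) (Icc 0 b) := by
  have hle : volume.restrict (Ioc 0 b) ≤ halfLine :=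
    Measure.restrict_mono (fun x hx => hx.1) le_rfl
  have hint : IntegrableOn (fun x => (ρ x).toReal) (Icc 0 b) := by
    rw [integrableOn_Icc_iff_integrableOn_Ioc]
    refine integrable_toReal_of_lintegral_ne_top (h.aemeasurable.mono_measure hle) ?_
    rw [lintegral_Ioc_eq]
    exact (h.lt_top b hb).ne
  exact (intervalIntegral.continuousOn_primitive hint).congr fun t ht =>
    (h.toReal_prim hb ht).symm

lemma totalMass_eq_iSup (ρ : ℝ → ℝ≥0∞) : totalMass ρ = ⨆ n : ℕ, prim ρ n := by
  have : Ioi (0 : ℝ) = ⋃ n : ℕ, Ioo (0 : ℝ) n := by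
    ext x
    simp only [mem_Ioi, mem_iUnion, mem_Ioo]
    exact ⟨fun hx => (exists_nat_gt x).imp fun n hn => ⟨hx, hn⟩, fun ⟨_, hx, _⟩ => hx⟩
  rw [totalMass, this, setLIntegral_iUnion_of_directed]
  · rfl
  · exact Monotone.directed_le fun m n hmn => Ioo_subset_Ioo_right (by exact_mod_cast hmn)

lemma IsDensity.exists_prim_eq (h : IsDensity ρ) {c : ℝ≥0∞} (h0 : c ≠ 0)
    (hc : c < totalMass ρ) : ∃ t, 0 < t ∧ prim ρ t = c := by
  rw [totalMass_eq_iSup, lt_iSup_iff] at hc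
  obtain ⟨n, hn⟩ := hc
  have hn0 : (0 : ℝ) < n := by
    by_contra! h'
    simp [prim, Ioo_eq_empty (not_lt.2 h')] at hn
  have hct : c ≠ ∞ := (hn.trans (h.lt_top n hn0)).ne
  have h00 : prim ρ 0 = 0 := by simp [prim]
  have := intermediate_value_Icc hn0.le (h.continuousOn hn0)
  obtain ⟨t, ht, hte⟩ := this (show c.toReal ∈ Icc _ _ from
    ⟨by simp [h00], ENNReal.toReal_mono (h.lt_top n hn0).ne hn.le⟩)
  have hte' : prim ρ t = c := by
    rw [← ENNReal.toReal_eq_toReal_iff' _ hct]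
    · exact hte
    · exact ((prim_mono ρ ht.2).trans_lt (h.lt_top n hn0)).ne
  refine ⟨t, lt_of_le_of_ne ht.1 ?_, hte'⟩
  rintro rfl
  exact h0 (hte'.symm.trans h00)

lemma IsDensity.lintegral_level_le (h : IsDensity ρ) (k : ℤ) :
    ∫⁻ x in level ρ k, ρ x ≤ 2 ^ ((k : ℝ) + 1) := by
  rcases lt_or_ge ((2 : ℝ≥0∞) ^ ((k : ℝ) + 1)) (totalMass ρ) with hlt | hge
  · obtain ⟨T, hT0, hT⟩ := h.exists_prim_eq (two_rpow_pos _) hlt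
    have hsub : level ρ k ⊆ Ioo 0 T := by
      refine fun x hx => ⟨hx.1, ?_⟩
      by_contra! hTx
      exact absurd hx.2.2 (not_lt.2 (hT.symm.le.trans (prim_mono ρ hTx)))
    exact (lintegral_mono_set hsub).trans hT.le
  · exact (lintegral_mono_set (level_subset ρ k)).trans hge

/-- The hypothesis says that the primitive does not stop growing inside level `k`; the level then
carries the full increment from `2^k` to `2^(k+1)`. -/
lemma IsDensity.le_lintegral_level (h : IsDensity ρ) (k : ℤ)
    (hk : (2 : ℝ≥0∞) ^ ((k : ℝ) + 1) ≤ totalMass ρ) :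
    2 ^ (k : ℝ) ≤ ∫⁻ x in level ρ k, ρ x := by
  have hlt : (2 : ℝ≥0∞) ^ (k : ℝ) < 2 ^ ((k : ℝ) + 1) :=
    ENNReal.rpow_lt_rpow_of_exponent_lt (by norm_num) (by norm_num) (by linarith)
  obtain ⟨a, ha0, ha⟩ := h.exists_prim_eq (two_rpow_pos _) (hlt.trans_le hk)
  -- The value `2^(k+1)` may equal the total mass and be attained at no finite point, so it is
  -- approached from below.
  have key : ∀ c < (2 : ℝ≥0∞) ^ ((k : ℝ) + 1), c ≤ 2 ^ (k : ℝ) + ∫⁻ x in level ρ k, ρ x := by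
    intro c hc
    rcases le_or_gt c (2 ^ (k : ℝ)) with hc' | hc'
    · exact hc'.trans le_self_add
    obtain ⟨b, hb0, hb⟩ := h.exists_prim_eq (ne_bot_of_gt hc') (hc.trans_le hk)
    rw [← hb, ← ha]
    have : Ioo 0 b ⊆ Ioo 0 a ∪ level ρ k := by
      intro x hx
      rcases lt_or_ge x a with hxa | hxa
      · exact Or.inl ⟨hx.1, hxa⟩
      · exact Or.inr ⟨hx.1, ha ▸ prim_mono ρ hxa, ((prim_mono ρ hx.2.le).trans hb.le).trans_lt hc⟩
    exact (lintegral_mono_set this).trans (lintegral_union_le _ _ _)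
  have h2 := le_of_forall_lt_imp_le_of_dense key
  rw [two_rpow_add, ENNReal.rpow_one, mul_two] at h2
  exact (ENNReal.add_le_add_iff_left (two_rpow_ne_top _)).1 h2

end CopCes

end

/-! ### Discrete Hardy and Hölder inequalities -/

noncomputable section

namespace CopCes

lemma tsum_geometric_rpow_ne_top {c : ℝ} (hc : c < 0) :
    ∑' m : ℕ, (2 : ℝ≥0∞) ^ ((m : ℝ) * c) ≠ ∞ := by
  have : ∀ m : ℕ, (2 : ℝ≥0∞) ^ ((m : ℝ) * c) = ((2 : ℝ≥0∞) ^ c) ^ m := fun m => by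
    rw [mul_comm, ENNReal.rpow_mul, ENNReal.rpow_natCast]
  simp_rw [this]
  rw [ENNReal.tsum_geometric]
  refine ENNReal.inv_ne_top.2 (tsub_pos_of_lt ?_).ne'
  exact ENNReal.rpow_lt_one_of_one_lt_of_neg (by norm_num) hc

/-- A power of a series is controlled by a geometrically weighted series of powers. -/
lemma rpow_tsum_le {α δ : ℝ} (hα : 0 < α) (y : ℕ → ℝ≥0∞) :
    (∑' m, y m) ^ α ≤ (∑' m : ℕ, (2 : ℝ≥0∞) ^ ((m : ℝ) * -δ)) ^ α *
      ∑' m : ℕ, (2 : ℝ≥0∞) ^ ((m : ℝ) * (δ * α)) * y m ^ α := by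
  set B : ℝ≥0∞ := ∑' m : ℕ, (2 : ℝ≥0∞) ^ ((m : ℝ) * (δ * α)) * y m ^ α
  -- Bounding each term by the whole of `B` treats `α ≤ 1` and `α ≥ 1` alike; the loss is only a
  -- geometric series.
  have hy : ∀ m, y m ≤ (2 : ℝ≥0∞) ^ ((m : ℝ) * -δ) * B ^ (1 / α) := by
    intro m
    have h1 : (2 : ℝ≥0∞) ^ ((m : ℝ) * (δ * α)) * y m ^ α ≤ B := ENNReal.le_tsum m
    have h2 : (2 : ℝ≥0∞) ^ ((m : ℝ) * δ) * y m ≤ B ^ (1 / α) := by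
      rw [one_div, ENNReal.le_rpow_inv_iff hα, ENNReal.mul_rpow_of_nonneg _ _ hα.le,
        ← ENNReal.rpow_mul, mul_assoc]
      exact h1
    calc y m = (2 : ℝ≥0∞) ^ ((m : ℝ) * -δ) * ((2 : ℝ≥0∞) ^ ((m : ℝ) * δ) * y m) := by
          rw [← mul_assoc, ← ENNReal.rpow_add _ _ (by simp) (by simp)]
          simp
      _ ≤ _ := by gcongr
  calc (∑' m, y m) ^ α ≤ (∑' m : ℕ, (2 : ℝ≥0∞) ^ ((m : ℝ) * -δ) * B ^ (1 / α)) ^ α := by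
        gcongr with m; exact hy m
    _ = _ := by
        rw [ENNReal.tsum_mul_right, ENNReal.mul_rpow_of_nonneg _ _ hα.le, ← ENNReal.rpow_mul,
          one_div_mul_cancel hα.ne', ENNReal.rpow_one]

/-- The discrete weighted Hardy inequality for tails, with geometric weights. -/
lemma exists_hardy_tail {α σ : ℝ} (hα : 0 < α) (hσ : 0 < σ) :
    ∃ C : ℝ≥0∞, C ≠ ∞ ∧ ∀ y : ℤ → ℝ≥0∞,
      ∑' k : ℤ, (2 : ℝ≥0∞) ^ ((k : ℝ) * σ) * (∑' m : ℕ, y (k + m)) ^ α ≤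
        C * ∑' k : ℤ, (2 : ℝ≥0∞) ^ ((k : ℝ) * σ) * y k ^ α := by
  -- Moving the weight from `k` to `k + m` gains `2^(-mσ)`. This `δ` spends half of the exponent on
  -- the power of the series, and the remaining `2^(-mσ/2)` is summable.
  set δ : ℝ := σ / (2 * α) with hδ
  have hδ0 : 0 < δ := by positivity
  have hδα : δ * α = σ / 2 := by rw [hδ]; field_simp
  set K : ℝ≥0∞ := (∑' m : ℕ, (2 : ℝ≥0∞) ^ ((m : ℝ) * -δ)) ^ α with hK
  refine ⟨K * ∑' m : ℕ, (2 : ℝ≥0∞) ^ ((m : ℝ) * -(σ / 2)), ENNReal.mul_ne_top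
    (ENNReal.rpow_ne_top_of_nonneg hα.le (tsum_geometric_rpow_ne_top (by linarith)))
    (tsum_geometric_rpow_ne_top (by linarith)), fun y => ?_⟩
  calc ∑' k : ℤ, (2 : ℝ≥0∞) ^ ((k : ℝ) * σ) * (∑' m : ℕ, y (k + m)) ^ α
      ≤ ∑' k : ℤ, (2 : ℝ≥0∞) ^ ((k : ℝ) * σ) *
          (K * ∑' m : ℕ, (2 : ℝ≥0∞) ^ ((m : ℝ) * (δ * α)) * y (k + m) ^ α) := by
        gcongr with k
        exact rpow_tsum_le hα _
    _ = K * ∑' m : ℕ, ∑' k : ℤ, (2 : ℝ≥0∞) ^ ((m : ℝ) * -(σ / 2)) *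
          ((2 : ℝ≥0∞) ^ (((k + m : ℤ) : ℝ) * σ) * y (k + m) ^ α) := by
        rw [ENNReal.tsum_comm, ← ENNReal.tsum_mul_left]
        refine tsum_congr fun k => ?_
        rw [← ENNReal.tsum_mul_left, ← ENNReal.tsum_mul_left, ← ENNReal.tsum_mul_left]
        refine tsum_congr fun m => ?_
        rw [hδα, ← mul_assoc ((2 : ℝ≥0∞) ^ ((m : ℝ) * -(σ / 2))),
          ← ENNReal.rpow_add _ _ (by simp) (by simp)]
        have : (m : ℝ) * -(σ / 2) + ((k + m : ℤ) : ℝ) * σ = (k : ℝ) * σ + (m : ℝ) * (σ / 2) := by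
          push_cast; ring
        rw [this, ENNReal.rpow_add _ _ (by simp) (by simp)]
        ring
    _ = _ := by
        rw [mul_assoc, ← ENNReal.tsum_mul_right]
        congr 1
        refine tsum_congr fun m => ?_
        rw [ENNReal.tsum_mul_left]
        congr 1
        exact (Equiv.addRight (m : ℤ)).tsum_eq
          (fun k : ℤ => (2 : ℝ≥0∞) ^ ((k : ℝ) * σ) * y k ^ α)

/-- The discrete weighted Hardy inequality for heads, with geometric weights. -/
lemma exists_hardy_head {α σ : ℝ} (hα : 0 < α) (hσ : 0 < σ) :
    ∃ C : ℝ≥0∞, C ≠ ∞ ∧ ∀ y : ℤ → ℝ≥0∞,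
      ∑' k : ℤ, (2 : ℝ≥0∞) ^ ((k : ℝ) * -σ) * (∑' m : ℕ, y (k - m)) ^ α ≤
        C * ∑' k : ℤ, (2 : ℝ≥0∞) ^ ((k : ℝ) * -σ) * y k ^ α := by
  obtain ⟨C, hC, h⟩ := exists_hardy_tail hα hσ
  refine ⟨C, hC, fun y => ?_⟩
  convert h (fun k => y (-k)) using 1
  · rw [← (Equiv.neg ℤ).tsum_eq]
    refine tsum_congr fun k => ?_
    simp only [Equiv.neg_apply, Int.cast_neg, neg_mul_neg, neg_add, sub_eq_add_neg]
  · rw [← (Equiv.neg ℤ).tsum_eq]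
    simp

/-- Hölder's inequality for three exponents and `ℤ`-indexed sums. -/
lemma tsum_mul_rpow_le {P S R : ℝ} (hP : 0 < P) (hPS : P < S) (h : 1 / P = 1 / S + 1 / R)
    (a b : ℤ → ℝ≥0∞) :
    (∑' k, (a k * b k) ^ P) ^ (1 / P) ≤
      (∑' k, a k ^ S) ^ (1 / S) * (∑' k, b k ^ R) ^ (1 / R) := by
  have := ENNReal.lintegral_Lp_mul_le_Lq_mul_Lr hP hPS h Measure.count
    (f := a) (g := b) (measurable_of_countable a).aemeasurable
    (measurable_of_countable b).aemeasurable
  simpa [lintegral_count] using this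

/-- Powers at most one are subadditive, for series. -/
lemma rpow_tsum_le_tsum_rpow {ι : Type*} {θ : ℝ} (h0 : 0 < θ) (h1 : θ ≤ 1) (y : ι → ℝ≥0∞) :
    (∑' i, y i) ^ θ ≤ ∑' i, y i ^ θ := by
  rw [← ENNReal.le_rpow_inv_iff h0, ENNReal.tsum_eq_iSup_sum]
  refine iSup_le fun s => ?_
  rw [ENNReal.le_rpow_inv_iff h0]
  refine le_trans ?_ (ENNReal.sum_le_tsum s)
  classical
  induction s using Finset.induction_on with
  | empty => simp [h0]
  | insert i s hi ih =>
    rw [Finset.sum_insert hi, Finset.sum_insert hi]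
    exact (ENNReal.rpow_add_le_add_rpow _ _ h0.le h1).trans (by gcongr)

end CopCes

end

/-! ### Discretization of the Copson functional -/

noncomputable section

namespace CopCes

variable {ρ : ℝ → ℝ≥0∞}

/-- The integral `∫₀^∞ (∫ₓ^∞ g)^R ρ(x) dx`. -/
def copInt (R : ℝ) (ρ g : ℝ → ℝ≥0∞) : ℝ≥0∞ :=
  ∫⁻ x in Ioi (0 : ℝ), (∫⁻ y in Ioi x, g y) ^ R * ρ x

/-- The dyadic sum `∑ₖ 2 ^ k (∫_{level k} g)^R`. -/
def copSum (R : ℝ) (ρ g : ℝ → ℝ≥0∞) : ℝ≥0∞ :=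
  ∑' k : ℤ, (2 : ℝ≥0∞) ^ (k : ℝ) * (∫⁻ y in level ρ k, g y) ^ R

lemma IsDensity.aemeasurable_level (h : IsDensity ρ) (k : ℤ) :
    AEMeasurable ρ (volume.restrict (level ρ k)) :=
  h.aemeasurable.mono_measure (Measure.restrict_mono (level_subset ρ k) le_rfl)

/-- For `x` in level `k - 1` the tail `(x,∞)` contains level `k`. If level `k` is nonempty, level `k
- 1` is full, and integrating over it recovers the weight `2^k` up to the factor `2`. -/
lemma IsDensity.copSum_le (h : IsDensity ρ) {R : ℝ} (hR : 0 < R) (g : ℝ → ℝ≥0∞) :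
    copSum R ρ g ≤ 2 * copInt R ρ g := by
  rw [copInt, lintegral_eq_tsum_level h, copSum, ← ENNReal.tsum_mul_left,
    ← (Equiv.subRight (1 : ℤ)).tsum_eq
      (fun k => 2 * ∫⁻ x in level ρ k, (∫⁻ y in Ioi x, g y) ^ R * ρ x)]
  refine ENNReal.tsum_le_tsum fun k => ?_
  simp only [Equiv.subRight_apply]
  rcases (level ρ k).eq_empty_or_nonempty with he | ⟨x₀, hx₀⟩
  · simp [he, hR]
  have hk : (2 : ℝ≥0∞) ^ (((k - 1 : ℤ) : ℝ) + 1) ≤ totalMass ρ := by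
    have : ((k - 1 : ℤ) : ℝ) + 1 = k := by push_cast; ring
    rw [this]
    exact hx₀.2.1.trans (prim_le_totalMass ρ x₀)
  have h2 : (2 : ℝ≥0∞) ^ (k : ℝ) = 2 * 2 ^ ((k - 1 : ℤ) : ℝ) := by
    have : (k : ℝ) = 1 + ((k - 1 : ℤ) : ℝ) := by push_cast; ring
    rw [this, two_rpow_add, ENNReal.rpow_one]
  calc (2 : ℝ≥0∞) ^ (k : ℝ) * (∫⁻ y in level ρ k, g y) ^ R
      ≤ 2 * ((∫⁻ y in level ρ k, g y) ^ R * ∫⁻ x in level ρ (k - 1), ρ x) := by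
        rw [h2, mul_assoc, mul_comm ((∫⁻ y in level ρ k, g y) ^ R)]
        gcongr
        exact h.le_lintegral_level _ hk
    _ = 2 * ∫⁻ x in level ρ (k - 1), (∫⁻ y in level ρ k, g y) ^ R * ρ x := by
        rw [lintegral_const_mul'' _ (h.aemeasurable_level _)]
    _ ≤ _ := by
        gcongr 2 * ?_
        refine setLIntegral_mono' (measurableSet_level _ _) fun x hx => ?_
        gcongr
        exact fun y hy => lt_of_mem_level (by omega) hx hy

lemma lintegral_tail_le (h : IsDensity ρ) (g : ℝ → ℝ≥0∞) {k : ℤ} {x : ℝ} (hx : x ∈ level ρ k) :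
    ∫⁻ y in Ioi x, g y ≤ ∑' m : ℕ, ∫⁻ y in level ρ (k + m), g y := by
  refine (lintegral_mono_set ?_).trans (lintegral_iUnion_le _ _)
  intro y (hy : x < y)
  have hy0 : y ∈ Ioi (0 : ℝ) := lt_trans hx.1 hy
  rw [← iUnion_level h] at hy0
  obtain ⟨j, hj⟩ := mem_iUnion.1 hy0
  have hkj : k ≤ j := by
    by_contra! hlt
    exact absurd (lt_of_mem_level hlt hj hx) (not_lt.2 hy.le)
  refine mem_iUnion.2 ⟨(j - k).toNat, ?_⟩
  rwa [Int.toNat_of_nonneg (by omega), add_sub_cancel]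

/-- A tail starting in level `k` is covered by the levels from `k` on, and level `k` has mass at
most `2^(k+1)`. Hardy's inequality for tails with `σ = 1` does the rest, uniformly in `ρ`. -/
lemma exists_copInt_le {R : ℝ} (hR : 0 < R) :
    ∃ C : ℝ≥0∞, C ≠ ∞ ∧ ∀ ρ : ℝ → ℝ≥0∞, IsDensity ρ → ∀ g : ℝ → ℝ≥0∞,
      copInt R ρ g ≤ C * copSum R ρ g := by
  obtain ⟨C, hC, hH⟩ := exists_hardy_tail hR one_pos
  refine ⟨2 * C, ENNReal.mul_ne_top (by simp) hC, fun ρ h g => ?_⟩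
  have hH' := hH fun k => ∫⁻ y in level ρ k, g y
  simp only [mul_one] at hH'
  rw [copInt, lintegral_eq_tsum_level h, mul_assoc]
  refine le_trans ?_ (mul_le_mul_right hH' 2)
  rw [← ENNReal.tsum_mul_left]
  refine ENNReal.tsum_le_tsum fun k => ?_
  calc ∫⁻ x in level ρ k, (∫⁻ y in Ioi x, g y) ^ R * ρ x
      ≤ ∫⁻ x in level ρ k, (∑' m : ℕ, ∫⁻ y in level ρ (k + m), g y) ^ R * ρ x := by
        refine setLIntegral_mono' (measurableSet_level _ _) fun x hx => ?_
        gcongr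
        exact lintegral_tail_le h g hx
    _ = (∑' m : ℕ, ∫⁻ y in level ρ (k + m), g y) ^ R * ∫⁻ x in level ρ k, ρ x := by
        rw [lintegral_const_mul'' _ (h.aemeasurable_level _)]
    _ ≤ (∑' m : ℕ, ∫⁻ y in level ρ (k + m), g y) ^ R * 2 ^ ((k : ℝ) + 1) := by
        gcongr
        exact h.lintegral_level_le k
    _ = _ := by
        rw [two_rpow_add, ENNReal.rpow_one]
        ring

end CopCes

end

/-! ### The exponent p' and the sharpness of Hölder's inequality -/

noncomputable section

namespace CopCes

lemma conjExp_one : conjExp 1 = ∞ := by simp [conjExp]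

lemma conjExp_toReal {p : ℝ≥0∞} (hp1 : p < 1) :
    (conjExp p).toReal = p.toReal / (1 - p.toReal) := by
  rw [conjExp, if_pos hp1, ENNReal.toReal_div, ENNReal.toReal_sub_of_le hp1.le (by simp),
    ENNReal.toReal_one]

lemma toReal_lt_one {p : ℝ≥0∞} (hp1 : p < 1) : p.toReal < 1 := by
  rw [← ENNReal.toReal_one]
  exact (ENNReal.toReal_lt_toReal hp1.ne_top (by simp)).2 hp1

lemma conjExp_toReal_pos {p : ℝ≥0∞} (hp : 0 < p) (hp1 : p < 1) : 0 < (conjExp p).toReal := by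
  rw [conjExp_toReal hp1]
  exact div_pos (ENNReal.toReal_pos hp.ne' hp1.ne_top) (sub_pos.2 (toReal_lt_one hp1))

lemma eLpNorm_conjExp {p : ℝ≥0∞} (hp : 0 < p) (hp1 : p < 1) (μ : Measure ℝ) (F : ℝ → ℝ≥0∞) :
    eLpNorm F (conjExp p) μ =
      (∫⁻ x, F x ^ (conjExp p).toReal ∂μ) ^ (1 / (conjExp p).toReal) := by
  have h := conjExp_toReal_pos hp hp1
  rw [ENNReal.toReal_pos_iff] at h
  rw [eLpNorm_eq_lintegral_rpow_enorm_toReal h.1.ne' h.2.ne]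
  rfl

lemma eLpNorm_conjExp_one (μ : Measure ℝ) (F : ℝ → ℝ≥0∞) :
    eLpNorm F (conjExp 1) μ = essSup F μ := by
  rw [conjExp_one, eLpNorm_exponent_top]
  rfl

/-- Hölder's inequality with the exponents `p ≤ 1`, `p'` and `1`. -/
lemma lintegral_mul_rpow_le {p : ℝ≥0∞} (hp : 0 < p) (hp1 : p ≤ 1) {μ : Measure ℝ}
    {F g : ℝ → ℝ≥0∞} (hF : AEMeasurable F μ) (hg : AEMeasurable g μ) :
    ∫⁻ x, (F x * g x) ^ p.toReal ∂μ ≤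
      (eLpNorm F (conjExp p) μ * ∫⁻ x, g x ∂μ) ^ p.toReal := by
  rcases hp1.eq_or_lt with rfl | hlt
  · rw [eLpNorm_conjExp_one]
    simp only [ENNReal.toReal_one, ENNReal.rpow_one]
    rw [← lintegral_const_mul'' _ hg]
    refine lintegral_mono_ae ?_
    filter_upwards [ENNReal.ae_le_essSup F] with x hx
    gcongr
  · have hP : 0 < p.toReal := ENNReal.toReal_pos hp.ne' hlt.ne_top
    have hP1 := toReal_lt_one hlt
    have h1P : 0 < 1 - p.toReal := sub_pos.2 hP1
    have hq := conjExp_toReal hlt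
    have := ENNReal.lintegral_Lp_mul_le_Lq_mul_Lr hP (q := (conjExp p).toReal) (r := 1)
      (by rw [hq, lt_div_iff₀ h1P]; nlinarith)
      (by rw [hq]; field_simp; ring) μ hF hg
    rw [eLpNorm_conjExp hp hlt, ← ENNReal.rpow_inv_le_iff hP, ← one_div]
    simpa using this

/-- Near-extremal functions for Hölder's inequality with the exponents `p ≤ 1`, `p'` and `1`. -/
lemma exists_near_extremal {p : ℝ≥0∞} (hp : 0 < p) (hp1 : p ≤ 1) {μ : Measure ℝ} [SigmaFinite μ]
    {F : ℝ → ℝ≥0∞} (hF : AEMeasurable F μ) {a : ℝ≥0∞} (ha : a < eLpNorm F (conjExp p) μ) :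
    ∃ g : ℝ → ℝ≥0∞, Measurable g ∧ ∫⁻ x, g x ∂μ = 1 ∧
      a ^ p.toReal ≤ ∫⁻ x, (F x * g x) ^ p.toReal ∂μ := by
  rcases hp1.eq_or_lt with rfl | hlt
  · rw [eLpNorm_conjExp_one] at ha
    -- For `p = 1` the test function is a normalized indicator of a set of finite positive measure
    -- on which `F > a`.
    have hpos : μ {x | a < F x} ≠ 0 := by
      intro h0
      refine absurd ha (not_lt.2 (essSup_le_of_ae_le a ?_))
      rw [Filter.EventuallyLE, ae_iff]
      simpa using h0
    have hnull : NullMeasurableSet {x | a < F x} μ := nullMeasurableSet_lt aemeasurable_const hF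
    obtain ⟨T, hTs, hTm, hTae⟩ := hnull.exists_measurable_subset_ae_eq
    obtain ⟨E, hEm, hET, hE0, hEt⟩ : ∃ E, MeasurableSet E ∧ E ⊆ T ∧ 0 < μ E ∧ μ E < ∞ := by
      have : 0 < μ T := by rw [measure_congr hTae]; exact pos_iff_ne_zero.2 hpos
      obtain ⟨E, h1, h2, h3, h4⟩ := Measure.exists_subset_measure_lt_top hTm this
      exact ⟨E, h1, h2, h3, h4⟩
    refine ⟨E.indicator fun _ => (μ E)⁻¹, measurable_const.indicator hEm, ?_, ?_⟩
    · rw [lintegral_indicator_const hEm, ENNReal.inv_mul_cancel hE0.ne' hEt.ne]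
    · simp only [ENNReal.toReal_one, ENNReal.rpow_one]
      calc a = ∫⁻ x in E, a * (μ E)⁻¹ ∂μ := by
            rw [setLIntegral_const, mul_assoc, ENNReal.inv_mul_cancel hE0.ne' hEt.ne, mul_one]
        _ ≤ ∫⁻ x in E, F x * E.indicator (fun _ => (μ E)⁻¹) x ∂μ := by
            refine setLIntegral_mono' hEm fun x hx => ?_
            rw [indicator_of_mem hx]
            gcongr
            exact (hTs (hET hx)).le
        _ ≤ _ := setLIntegral_le_lintegral _ _
  · set q := (conjExp p).toReal with hqdef
    have hP : 0 < p.toReal := ENNReal.toReal_pos hp.ne' hlt.ne_top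
    have h1P : 0 < 1 - p.toReal := sub_pos.2 (toReal_lt_one hlt)
    have hq : q = p.toReal / (1 - p.toReal) := conjExp_toReal hlt
    have hq0 : 0 < q := conjExp_toReal_pos hp hlt
    rw [eLpNorm_conjExp hp hlt, ← hqdef, one_div, ENNReal.lt_rpow_inv_iff hq0] at ha
    -- The extremal function would be a multiple of `F^(p')`, whose integral may be infinite. A
    -- minorant `h` with finite integral above `a^(p')` replaces it.
    obtain ⟨h, hhm, hhle, hhint, hht⟩ : ∃ h : ℝ → ℝ≥0∞, Measurable h ∧
        (∀ᵐ x ∂μ, h x ≤ F x ^ q) ∧ a ^ q < ∫⁻ x, h x ∂μ ∧ ∫⁻ x, h x ∂μ < ∞ := by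
      rw [lintegral_eq_nnreal] at ha
      simp only [lt_iSup_iff] at ha
      obtain ⟨φ, hφ, ha⟩ := ha
      rw [← SimpleFunc.lintegral_eq_lintegral] at ha
      obtain ⟨ψ, hψφ, hψt, hψ⟩ := SimpleFunc.exists_lt_lintegral_simpleFunc_of_lt_lintegral ha
      refine ⟨fun x => ψ x, ψ.measurable.coe_nnreal_ennreal, ?_, hψ, hψt⟩
      exact Filter.Eventually.of_forall fun x =>
        (ENNReal.coe_le_coe.2 (hψφ x)).trans (hφ x)
    set I := ∫⁻ x, h x ∂μ
    have hI0 : I ≠ 0 := (bot_le.trans_lt hhint).ne'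
    refine ⟨fun x => I⁻¹ * h x, hhm.const_mul _, ?_, ?_⟩
    · rw [lintegral_const_mul _ hhm, ENNReal.inv_mul_cancel hI0 hht.ne]
    · calc a ^ p.toReal = (a ^ q) ^ (1 - p.toReal) := by
            rw [← ENNReal.rpow_mul, hq]; congr 1; field_simp
        _ ≤ I ^ (1 - p.toReal) := by gcongr
        _ = (I⁻¹) ^ p.toReal * I := by
            rw [ENNReal.rpow_sub _ _ hI0 hht.ne, ENNReal.rpow_one, ENNReal.inv_rpow,
              ENNReal.div_eq_inv_mul]
        _ = ∫⁻ x, (I⁻¹) ^ p.toReal * h x ∂μ := by rw [lintegral_const_mul _ hhm]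
        _ ≤ _ := by
            refine lintegral_mono_ae ?_
            filter_upwards [hhle] with x hx
            rw [mul_left_comm, ENNReal.mul_rpow_of_nonneg _ _ hP.le,
              ENNReal.mul_rpow_of_nonneg _ _ hP.le]
            gcongr
            -- This is `h ≤ F^(p')` raised to the power `1 - p`, since `p' (1 - p) = p`.
            have h1 : h x ^ (1 - p.toReal) ≤ F x ^ p.toReal := by
              have := ENNReal.rpow_le_rpow hx h1P.le
              rwa [← ENNReal.rpow_mul, hq, div_mul_cancel₀ _ h1P.ne'] at this
            calc h x = h x ^ (1 - p.toReal) * h x ^ p.toReal := by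
                  rw [← ENNReal.rpow_add_of_nonneg _ _ h1P.le hP.le]; simp
              _ ≤ _ := by gcongr

/-- The `L_{p'}` functional of a countable union is controlled by those of the pieces. -/
lemma exists_eLpNorm_iUnion_le {p : ℝ≥0∞} (hp : 0 < p) (hp1 : p ≤ 1) :
    ∃ β : ℝ, 0 < β ∧ ∀ (F : ℝ → ℝ≥0∞) (E : ℕ → Set ℝ),
      eLpNorm F (conjExp p) (volume.restrict (⋃ m, E m)) ^ β ≤
        ∑' m, eLpNorm F (conjExp p) (volume.restrict (E m)) ^ β := by
  rcases hp1.eq_or_lt with rfl | hlt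
  -- Here `β = 1`, as a supremum is at most a sum; for `p < 1` the choice is `β = p'`. Having some
  -- `β` lets later arguments ignore whether `p'` is infinite.
  · refine ⟨1, one_pos, fun F E => ?_⟩
    simp only [eLpNorm_conjExp_one, ENNReal.rpow_one]
    refine essSup_le_of_ae_le _ ?_
    rw [Filter.EventuallyLE, ae_restrict_iUnion_iff]
    intro m
    filter_upwards [ENNReal.ae_le_essSup (μ := volume.restrict (E m)) F] with x hx
    exact hx.trans (ENNReal.le_tsum m)
  · have hq0 := conjExp_toReal_pos hp hlt
    refine ⟨_, hq0, fun F E => ?_⟩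
    simp only [eLpNorm_conjExp hp hlt, ← ENNReal.rpow_mul, one_div_mul_cancel hq0.ne',
      ENNReal.rpow_one]
    exact lintegral_iUnion_le _ _

end CopCes

end

/-! ### Discretization of the Cesàro functional -/

noncomputable section

namespace CopCes

variable {ρ F : ℝ → ℝ≥0∞} {p : ℝ≥0∞}

/-- The `L_{p'}` functional of `F` on a set. -/
def conjNorm (p : ℝ≥0∞) (F : ℝ → ℝ≥0∞) (E : Set ℝ) : ℝ≥0∞ :=
  eLpNorm F (conjExp p) (volume.restrict E)

lemma conjNorm_mono {E E' : Set ℝ} (h : E ⊆ E') : conjNorm p F E ≤ conjNorm p F E' :=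
  eLpNorm_mono_measure _ (Measure.restrict_mono h le_rfl)

@[simp] lemma conjNorm_empty : conjNorm p F ∅ = 0 := by simp [conjNorm]

lemma rpow_le_rpow_of_nonpos {a b : ℝ≥0∞} {z : ℝ} (hz : z ≤ 0) (h : a ≤ b) : b ^ z ≤ a ^ z := by
  rw [← neg_neg z, ENNReal.rpow_neg b, ENNReal.rpow_neg a]
  exact ENNReal.inv_le_inv.2 (ENNReal.rpow_le_rpow h (neg_nonneg.2 hz))

lemma Ioo_subset_iUnion_level (h : IsDensity ρ) {k : ℤ} {t : ℝ} (ht : t ∈ level ρ k) :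
    Ioo 0 t ⊆ ⋃ m : ℕ, level ρ (k - m) := by
  intro y hy
  have hy0 : y ∈ Ioi (0 : ℝ) := hy.1
  rw [← iUnion_level h] at hy0
  obtain ⟨j, hj⟩ := mem_iUnion.1 hy0
  have hkj : j ≤ k := by
    by_contra! hlt
    exact absurd (lt_of_mem_level hlt ht hj) (not_lt.2 hy.2.le)
  refine mem_iUnion.2 ⟨(k - j).toNat, ?_⟩
  rwa [Int.toNat_of_nonneg (by omega), sub_sub_cancel]

lemma Ioi_subset_iUnion_level (h : IsDensity ρ) {k : ℤ}
    (hk : totalMass ρ < 2 ^ ((k : ℝ) + 1)) : Ioi 0 ⊆ ⋃ m : ℕ, level ρ (k - m) := by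
  intro y hy0
  rw [← iUnion_level h] at hy0
  obtain ⟨j, hj⟩ := mem_iUnion.1 hy0
  have hkj : j ≤ k := by
    by_contra! hlt
    have h1 : (k : ℝ) + 1 ≤ j := by exact_mod_cast hlt
    exact absurd (hk.trans_le (two_rpow_mono h1))
      (not_lt.2 (hj.2.1.trans (prim_le_totalMass ρ y)))
  refine mem_iUnion.2 ⟨(k - j).toNat, ?_⟩
  rwa [Int.toNat_of_nonneg (by omega), sub_sub_cancel]

lemma conjNorm_Ioi_le (hp : 0 < p) (hp1 : p ≤ 1) {c : ℝ≥0∞}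
    (h : ∀ n : ℕ, conjNorm p F (Ioo 0 n) ≤ c) : conjNorm p F (Ioi 0) ≤ c := by
  have hU : Ioi (0 : ℝ) = ⋃ n : ℕ, Ioo (0 : ℝ) n := by
    ext x
    simp only [mem_Ioi, mem_iUnion, mem_Ioo]
    exact ⟨fun hx => (exists_nat_gt x).imp fun n hn => ⟨hx, hn⟩, fun ⟨_, hx, _⟩ => hx⟩
  unfold conjNorm at *
  rw [hU]
  rcases hp1.eq_or_lt with rfl | hlt
  · simp only [eLpNorm_conjExp_one] at *
    refine essSup_le_of_ae_le _ ?_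
    rw [Filter.EventuallyLE, ae_restrict_iUnion_iff]
    intro m
    filter_upwards [ENNReal.ae_le_essSup (μ := volume.restrict (Ioo (0 : ℝ) m)) F] with x hx
    exact hx.trans (h m)
  · have hq0 := conjExp_toReal_pos hp hlt
    simp only [eLpNorm_conjExp hp hlt, one_div, ENNReal.rpow_inv_le_iff hq0] at *
    rw [setLIntegral_iUnion_of_directed]
    · exact iSup_le h
    · exact Monotone.directed_le fun m n hmn => Ioo_subset_Ioo_right (by exact_mod_cast hmn)

lemma exists_mem_of_ae_halfLine {Q : ℝ → Prop} (h : ∀ᵐ t ∂halfLine, Q t) {E : Set ℝ}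
    (hE : E ⊆ Ioi 0) (hE0 : volume E ≠ 0) : ∃ t ∈ E, Q t :=
  Measure.exists_mem_of_measure_ne_zero_of_ae hE0 (ae_restrict_of_ae_restrict_of_subset hE h)

/-- An essential supremum controls only almost every `t`, so a good `t` to the right of level `k`
with primitive at most `2^(k+2)` is needed. A full level `k + 1` has positive measure and contains
one. Otherwise the total mass is below `2^(k+2)`, and arbitrarily large good `t` serve. -/
lemma conjNorm_level_le_of_ae (hp : 0 < p) (hp1 : p ≤ 1) (h : IsDensity ρ) {R : ℝ} (hR : 0 < R)
    {S : ℝ≥0∞} (hS : ∀ᵐ t ∂halfLine, conjNorm p F (Ioo 0 t) ≤ S * prim ρ t ^ (1 / R)) (k : ℤ) :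
    conjNorm p F (level ρ k) ≤ 2 ^ (2 / R) * S * 2 ^ ((k : ℝ) / R) := by
  have hpow : ∀ t, prim ρ t ≤ 2 ^ ((k : ℝ) + 2) →
      S * prim ρ t ^ (1 / R) ≤ 2 ^ (2 / R) * S * 2 ^ ((k : ℝ) / R) := by
    intro t ht
    calc S * prim ρ t ^ (1 / R) ≤ S * (2 ^ ((k : ℝ) + 2)) ^ (1 / R) := by gcongr
      _ = _ := by
        rw [← ENNReal.rpow_mul, mul_comm (2 ^ (2 / R)) S, mul_assoc, ← two_rpow_add]
        congr 2
        ring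
  rcases le_or_gt ((2 : ℝ≥0∞) ^ ((k : ℝ) + 2)) (totalMass ρ) with hge | hlt
  · have hcast : ((k + 1 : ℤ) : ℝ) + 1 = (k : ℝ) + 2 := by push_cast; ring
    have h1 := h.le_lintegral_level (k + 1) (by rwa [hcast])
    obtain ⟨t, ht, htS⟩ := exists_mem_of_ae_halfLine hS (level_subset ρ (k + 1)) (by
      intro h0
      rw [Measure.restrict_eq_zero.2 h0, lintegral_zero_measure] at h1
      exact two_rpow_pos _ (le_zero_iff.1 h1))
    have hsub : level ρ k ⊆ Ioo 0 t := fun x hx => ⟨hx.1, lt_of_mem_level (by omega) hx ht⟩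
    exact (conjNorm_mono hsub).trans (htS.trans (hpow t (hcast ▸ ht.2.2.le)))
  · refine (conjNorm_mono (level_subset ρ k)).trans (conjNorm_Ioi_le hp hp1 fun n => ?_)
    obtain ⟨t, ht, htS⟩ := exists_mem_of_ae_halfLine hS (E := Ioi (n : ℝ))
      (Ioi_subset_Ioi n.cast_nonneg) (by simp)
    refine (conjNorm_mono (Ioo_subset_Ioo_right (le_of_lt ht))).trans (htS.trans (hpow t ?_))
    exact (prim_le_totalMass ρ t).trans hlt.le

/-- The bounds on the levels below `t` decay geometrically, so their union costs no more than a
constant times the bound on the level of `t`. -/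
lemma exists_conjNorm_Ioo_le (hp : 0 < p) (hp1 : p ≤ 1) {R : ℝ} (hR : 0 < R) :
    ∃ C : ℝ≥0∞, C ≠ ∞ ∧ ∀ ρ : ℝ → ℝ≥0∞, IsDensity ρ → ∀ (F : ℝ → ℝ≥0∞) (A : ℝ≥0∞),
      (∀ k, conjNorm p F (level ρ k) ≤ A * 2 ^ ((k : ℝ) / R)) →
      ∀ t, 0 < t → conjNorm p F (Ioo 0 t) ≤ C * A * prim ρ t ^ (1 / R) := by
  obtain ⟨β, hβ, hU⟩ := exists_eLpNorm_iUnion_le hp hp1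
  set G : ℝ≥0∞ := ∑' m : ℕ, (2 : ℝ≥0∞) ^ ((m : ℝ) * -(β / R))
  have hG : G ≠ ∞ := tsum_geometric_rpow_ne_top (neg_lt_zero.2 (by positivity))
  refine ⟨G ^ (1 / β), ENNReal.rpow_ne_top_of_nonneg (by positivity) hG,
    fun ρ h F A hA t ht => ?_⟩
  have ht' : t ∈ Ioi (0 : ℝ) := ht
  rw [← iUnion_level h] at ht'
  obtain ⟨k, hk⟩ := mem_iUnion.1 ht'
  have key : conjNorm p F (Ioo 0 t) ^ β ≤ G * (A * 2 ^ ((k : ℝ) / R)) ^ β := by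
    calc conjNorm p F (Ioo 0 t) ^ β
        ≤ conjNorm p F (⋃ m : ℕ, level ρ (k - m)) ^ β := by
          gcongr
          exact conjNorm_mono (Ioo_subset_iUnion_level h hk)
      _ ≤ ∑' m : ℕ, conjNorm p F (level ρ (k - m)) ^ β := hU F _
      _ ≤ ∑' m : ℕ, (2 : ℝ≥0∞) ^ ((m : ℝ) * -(β / R)) * (A * 2 ^ ((k : ℝ) / R)) ^ β := by
          refine ENNReal.tsum_le_tsum fun m => ?_
          refine (ENNReal.rpow_le_rpow (hA (k - m)) hβ.le).trans_eq ?_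
          have : (2 : ℝ≥0∞) ^ ((m : ℝ) * -(β / R)) = (2 ^ (-(m : ℝ) / R)) ^ β := by
            rw [← ENNReal.rpow_mul]; congr 1; ring
          rw [this, ← ENNReal.mul_rpow_of_nonneg _ _ hβ.le, mul_left_comm, ← two_rpow_add]
          congr 3
          push_cast
          ring
      _ = _ := ENNReal.tsum_mul_right
  rw [← ENNReal.le_rpow_inv_iff hβ, ENNReal.mul_rpow_of_nonneg _ _ (by positivity),
    ENNReal.rpow_rpow_inv hβ.ne', ← one_div] at key
  refine key.trans ?_
  rw [← mul_assoc]
  gcongr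
  calc (2 : ℝ≥0∞) ^ ((k : ℝ) / R) = (2 ^ (k : ℝ)) ^ (1 / R) := by
        rw [← ENNReal.rpow_mul]; congr 1; ring
    _ ≤ _ := ENNReal.rpow_le_rpow hk.2.1 (by positivity)

/-- The integral `∫₀^∞ ‖F‖_{p',(0,t)}^S (∫₀ᵗ ρ)^{-(1 + S/R)} ρ(t) dt`. -/
def cesInt (p : ℝ≥0∞) (S R : ℝ) (ρ F : ℝ → ℝ≥0∞) : ℝ≥0∞ :=
  ∫⁻ t in Ioi (0 : ℝ), conjNorm p F (Ioo 0 t) ^ S * (prim ρ t ^ (-(1 + S / R)) * ρ t)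

/-- The dyadic sum `∑ₖ 2 ^ (-k S / R) ‖F‖_{p', level k}^S`. -/
def cesSum (p : ℝ≥0∞) (S R : ℝ) (ρ F : ℝ → ℝ≥0∞) : ℝ≥0∞ :=
  ∑' k : ℤ, (2 : ℝ≥0∞) ^ ((k : ℝ) * -(S / R)) * conjNorm p F (level ρ k) ^ S

/-- The contribution `‖F‖_{p',(0,∞)} / ‖u‖_{R,(0,∞)}` of the point at infinity. -/
def endTerm (p : ℝ≥0∞) (R : ℝ) (ρ F : ℝ → ℝ≥0∞) : ℝ≥0∞ :=
  (totalMass ρ ^ (1 / R))⁻¹ * conjNorm p F (Ioi 0)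

/-- At most two indices satisfy the condition, and none if the mass is infinite. These are the
levels charged to `endTerm`. -/
lemma tsum_ite_level_le (ρ : ℝ → ℝ≥0∞) (hρ : totalMass ρ ≠ 0) (D : ℝ≥0∞) :
    ∑' k : ℤ, (if (2 : ℝ≥0∞) ^ (k : ℝ) ≤ totalMass ρ ∧ totalMass ρ < 2 ^ ((k : ℝ) + 2)
      then D else 0) ≤ 2 * D := by
  classical
  rcases eq_or_ne (totalMass ρ) ∞ with ht | ht
  · simp [ht]
  obtain ⟨K, hK1, hK2⟩ := exists_two_rpow_le_lt hρ ht
  rw [tsum_eq_sum (s := {K - 1, K})]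
  · refine (Finset.sum_le_card_nsmul _ _ D fun k _ => by split_ifs <;> simp).trans ?_
    rw [nsmul_eq_mul]
    gcongr
    exact_mod_cast Finset.card_le_two
  · intro k hk
    rw [if_neg]
    rintro ⟨h1, h2⟩
    have h3 := h1.trans_lt hK2
    have h4 := hK1.trans_lt h2
    have h5 : (k : ℝ) < K + 1 := by
      by_contra! h'
      exact absurd h3 (not_lt.2 (two_rpow_mono h'))
    have h6 : (K : ℝ) < k + 2 := by
      by_contra! h'
      exact absurd h4 (not_lt.2 (two_rpow_mono h'))
    have h7 : k < K + 1 := by exact_mod_cast h5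
    have h8 : K < k + 2 := by exact_mod_cast h6
    simp only [Finset.mem_insert, Finset.mem_singleton] at hk
    omega

/-- If level `k + 1` is full, the part of the integral over it dominates the `k`-th term, because
`(0,t)` contains level `k` for every `t` there. If the total mass is below `2^(k+2)`, a nonempty
level `k` is compared with the whole half-line instead. -/
lemma cesSum_le (h : IsDensity ρ) {S R : ℝ} (hS : 0 < S) (hR : 0 < R) (F : ℝ → ℝ≥0∞) :
    cesSum p S R ρ F ≤
      2 ^ (1 + 2 * (S / R)) * cesInt p S R ρ F + 2 * (2 ^ (2 * (S / R)) * endTerm p R ρ F ^ S) := by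
  have hσ : 0 < S / R := by positivity
  have hρ0 : totalMass ρ ≠ 0 := ((h.pos 1 one_pos).trans_le (prim_le_totalMass ρ 1)).ne'
  refine le_trans ?_ (add_le_add_right (tsum_ite_level_le ρ hρ0 _) _)
  rw [cesInt, lintegral_eq_tsum_level h, ← (Equiv.addRight (1 : ℤ)).tsum_eq
    (fun k => ∫⁻ t in level ρ k, _), ← ENNReal.tsum_mul_left, ← ENNReal.tsum_add]
  refine ENNReal.tsum_le_tsum fun k => ?_
  simp only [Equiv.coe_addRight]
  rcases le_or_gt ((2 : ℝ≥0∞) ^ ((k : ℝ) + 2)) (totalMass ρ) with hge | hlt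
  · refine le_trans ?_ le_self_add
    have hcast : ((k + 1 : ℤ) : ℝ) + 1 = (k : ℝ) + 2 := by push_cast; ring
    have h1 := h.le_lintegral_level (k + 1) (by rwa [hcast])
    calc (2 : ℝ≥0∞) ^ ((k : ℝ) * -(S / R)) * conjNorm p F (level ρ k) ^ S
        = 2 ^ (1 + 2 * (S / R)) * (conjNorm p F (level ρ k) ^ S *
            (2 ^ ((k : ℝ) + 2)) ^ (-(1 + S / R)) * 2 ^ ((k + 1 : ℤ) : ℝ)) := by
          rw [← ENNReal.rpow_mul, mul_assoc (conjNorm _ _ _ ^ S), mul_left_comm, ← two_rpow_add,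
            ← two_rpow_add, mul_comm]
          congr 2
          push_cast
          ring
      _ ≤ 2 ^ (1 + 2 * (S / R)) * (conjNorm p F (level ρ k) ^ S *
            (2 ^ ((k : ℝ) + 2)) ^ (-(1 + S / R)) * ∫⁻ t in level ρ (k + 1), ρ t) := by
          gcongr
      _ = 2 ^ (1 + 2 * (S / R)) * ∫⁻ t in level ρ (k + 1), conjNorm p F (level ρ k) ^ S *
            (2 ^ ((k : ℝ) + 2)) ^ (-(1 + S / R)) * ρ t := by
          rw [lintegral_const_mul'' _ (h.aemeasurable_level _)]
      _ ≤ _ := by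
          gcongr 2 ^ (1 + 2 * (S / R)) * ?_
          refine setLIntegral_mono' (measurableSet_level _ _) fun t ht => ?_
          rw [mul_assoc]
          have hsub : level ρ k ⊆ Ioo 0 t :=
            fun x hx => ⟨hx.1, lt_of_mem_level (by omega) hx ht⟩
          gcongr ?_ ^ S * (?_ * _)
          · exact conjNorm_mono hsub
          · exact rpow_le_rpow_of_nonpos (by linarith) (hcast ▸ ht.2.2.le)
  · refine le_trans ?_ le_add_self
    rcases (level ρ k).eq_empty_or_nonempty with he | ⟨x₀, hx₀⟩
    · simp [he, hS]
    rw [if_pos ⟨hx₀.2.1.trans (prim_le_totalMass ρ x₀), hlt⟩, endTerm,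
      ENNReal.mul_rpow_of_nonneg _ _ hS.le, ← mul_assoc]
    gcongr
    · rw [ENNReal.inv_rpow, ← ENNReal.rpow_mul, ← ENNReal.rpow_neg]
      calc (2 : ℝ≥0∞) ^ ((k : ℝ) * -(S / R))
          = 2 ^ (2 * (S / R)) * (2 ^ ((k : ℝ) + 2)) ^ (-(1 / R * S)) := by
            rw [← ENNReal.rpow_mul, ← two_rpow_add]
            congr 1
            ring
        _ ≤ _ := by
            gcongr 2 ^ (2 * (S / R)) * ?_
            refine rpow_le_rpow_of_nonpos ?_ hlt.le
            have : 0 < 1 / R * S := by positivity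
            linarith
    · exact conjNorm_mono (level_subset ρ k)

/-- Both `(0,t)` with `t` in level `k` and, for the top index `k`, the whole half-line are covered
by levels of index at most `k`. Both bounds thus follow from Hardy's inequality for heads, applied
to the `β`-th powers of the level norms. -/
lemma exists_le_cesSum (hp : 0 < p) (hp1 : p ≤ 1) {S R : ℝ} (hS : 0 < S) (hR : 0 < R) :
    ∃ C : ℝ≥0∞, C ≠ ∞ ∧ ∀ ρ : ℝ → ℝ≥0∞, IsDensity ρ → ∀ F : ℝ → ℝ≥0∞,
      cesInt p S R ρ F ≤ C * cesSum p S R ρ F ∧ endTerm p R ρ F ^ S ≤ C * cesSum p S R ρ F := by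
  obtain ⟨β, hβ, hU⟩ := exists_eLpNorm_iUnion_le hp hp1
  have hσ : 0 < S / R := by positivity
  have hα : 0 < S / β := by positivity
  obtain ⟨C, hC, hH⟩ := exists_hardy_head hα hσ
  refine ⟨2 * C, ENNReal.mul_ne_top (by simp) hC, fun ρ h F => ?_⟩
  have hβS : ∀ c : ℝ≥0∞, (c ^ β) ^ (S / β) = c ^ S := fun c => by
    rw [← ENNReal.rpow_mul, mul_div_cancel₀ _ hβ.ne']
  have hH' := hH fun k => conjNorm p F (level ρ k) ^ β
  simp only [hβS] at hH'
  have hhead : ∀ (E : Set ℝ) (k : ℤ), E ⊆ ⋃ m : ℕ, level ρ (k - m) →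
      conjNorm p F E ^ S ≤ (∑' m : ℕ, conjNorm p F (level ρ (k - m)) ^ β) ^ (S / β) := by
    intro E k hE
    rw [← hβS]
    gcongr
    exact (ENNReal.rpow_le_rpow (conjNorm_mono hE) hβ.le).trans (hU F _)
  constructor
  · rw [cesInt, lintegral_eq_tsum_level h, mul_assoc]
    refine le_trans ?_ (mul_le_mul_right hH' 2)
    rw [← ENNReal.tsum_mul_left]
    refine ENNReal.tsum_le_tsum fun k => ?_
    set H := (∑' m : ℕ, conjNorm p F (level ρ (k - m)) ^ β) ^ (S / β)
    calc ∫⁻ t in level ρ k, conjNorm p F (Ioo 0 t) ^ S * (prim ρ t ^ (-(1 + S / R)) * ρ t)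
        ≤ ∫⁻ t in level ρ k, H * (2 ^ (k : ℝ)) ^ (-(1 + S / R)) * ρ t := by
          refine setLIntegral_mono' (measurableSet_level _ _) fun t ht => ?_
          rw [mul_assoc]
          gcongr ?_ * (?_ * _)
          · exact hhead _ k (Ioo_subset_iUnion_level h ht)
          · exact rpow_le_rpow_of_nonpos (by linarith) ht.2.1
      _ = H * (2 ^ (k : ℝ)) ^ (-(1 + S / R)) * ∫⁻ t in level ρ k, ρ t := by
          rw [lintegral_const_mul'' _ (h.aemeasurable_level _)]
      _ ≤ H * (2 ^ (k : ℝ)) ^ (-(1 + S / R)) * 2 ^ ((k : ℝ) + 1) := by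
          gcongr
          exact h.lintegral_level_le k
      _ = _ := by
          have : 2 * ((2 : ℝ≥0∞) ^ ((k : ℝ) * -(S / R)) * H) =
              H * (2 ^ (1 : ℝ) * (2 : ℝ≥0∞) ^ ((k : ℝ) * -(S / R))) := by
            rw [ENNReal.rpow_one]; ring
          rw [this, ← ENNReal.rpow_mul, mul_assoc, ← two_rpow_add, ← two_rpow_add]
          congr 2
          ring
  -- For infinite mass the end term is zero, by `1/∞ = 0` and `0 * ∞ = 0`.
  · rcases eq_or_ne (totalMass ρ) ∞ with ht | ht
    · simp [endTerm, ht, hR, hS]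
    have hρ0 : totalMass ρ ≠ 0 := ((h.pos 1 one_pos).trans_le (prim_le_totalMass ρ 1)).ne'
    obtain ⟨K, hK1, hK2⟩ := exists_two_rpow_le_lt hρ0 ht
    calc endTerm p R ρ F ^ S
        ≤ (2 : ℝ≥0∞) ^ ((K : ℝ) * -(S / R)) *
            (∑' m : ℕ, conjNorm p F (level ρ (K - m)) ^ β) ^ (S / β) := by
          rw [endTerm, ENNReal.mul_rpow_of_nonneg _ _ hS.le]
          gcongr
          · rw [ENNReal.inv_rpow, ← ENNReal.rpow_mul, ← ENNReal.rpow_neg]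
            calc totalMass ρ ^ (-(1 / R * S)) ≤ (2 ^ (K : ℝ)) ^ (-(1 / R * S)) := by
                  refine rpow_le_rpow_of_nonpos ?_ hK1
                  have : 0 < 1 / R * S := by positivity
                  linarith
              _ = _ := by rw [← ENNReal.rpow_mul]; congr 1; ring
          · exact hhead _ K (Ioi_subset_iUnion_level h hK2)
      _ ≤ _ := ENNReal.le_tsum (f := fun k : ℤ => (2 : ℝ≥0∞) ^ ((k : ℝ) * -(S / R)) *
            (∑' m : ℕ, conjNorm p F (level ρ (k - m)) ^ β) ^ (S / β)) K
      _ ≤ C * cesSum p S R ρ F := hH'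
      _ ≤ _ := by
          gcongr
          exact le_mul_of_one_le_left' (by norm_num)

end CopCes

end

/-! ### The multiplier inequality for sequences of levels -/

noncomputable section

namespace CopCes

variable {ρ F g : ℝ → ℝ≥0∞} {p : ℝ≥0∞}

/-- The integral `∫₀^∞ (F g)^P`. -/
def multInt (P : ℝ) (F g : ℝ → ℝ≥0∞) : ℝ≥0∞ := ∫⁻ x in Ioi (0 : ℝ), (F x * g x) ^ P

lemma aemeasurable_level {f : ℝ → ℝ≥0∞} (hf : AEMeasurable f halfLine) (k : ℤ) :
    AEMeasurable f (volume.restrict (level ρ k)) :=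
  hf.mono_measure (Measure.restrict_mono (level_subset ρ k) le_rfl)

lemma multInt_le_tsum (hp : 0 < p) (hp1 : p ≤ 1) (h : IsDensity ρ) (hF : AEMeasurable F halfLine)
    (hg : AEMeasurable g halfLine) :
    multInt p.toReal F g ≤
      ∑' k, (conjNorm p F (level ρ k) * ∫⁻ x in level ρ k, g x) ^ p.toReal := by
  rw [multInt, lintegral_eq_tsum_level h]
  exact ENNReal.tsum_le_tsum fun k =>
    lintegral_mul_rpow_le hp hp1 (aemeasurable_level hF k) (aemeasurable_level hg k)

lemma two_rpow_div_rpow {R : ℝ} (hR : 0 < R) (k : ℝ) (b : ℝ≥0∞) :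
    ((2 : ℝ≥0∞) ^ (k / R) * b) ^ R = 2 ^ k * b ^ R := by
  rw [ENNReal.mul_rpow_of_nonneg _ _ hR.le, ← ENNReal.rpow_mul, div_mul_cancel₀ _ hR.ne']

/-- Hölder on each level is followed by the embedding of `ℓ^R` into `ℓ^p`, which has constant one
for `R ≤ p`. -/
lemma multInt_le_of_le (hp : 0 < p) (hp1 : p ≤ 1) {R : ℝ} (hR : 0 < R) (hRp : R ≤ p.toReal)
    (h : IsDensity ρ) (hF : AEMeasurable F halfLine) (hg : AEMeasurable g halfLine) {A : ℝ≥0∞}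
    (hA : ∀ k, conjNorm p F (level ρ k) ≤ A * 2 ^ ((k : ℝ) / R)) :
    multInt p.toReal F g ^ (1 / p.toReal) ≤ A * copSum R ρ g ^ (1 / R) := by
  have hP : 0 < p.toReal := hR.trans_le hRp
  set b : ℤ → ℝ≥0∞ := fun k => ∫⁻ x in level ρ k, g x with hb
  set y : ℤ → ℝ≥0∞ := fun k => 2 ^ ((k : ℝ) / R) * b k
  have hsub := rpow_tsum_le_tsum_rpow (div_pos hR hP) ((div_le_one hP).2 hRp)
    fun k => y k ^ p.toReal
  have hpow : ∀ k, (y k ^ p.toReal) ^ (R / p.toReal) = 2 ^ (k : ℝ) * b k ^ R := fun k => by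
    rw [← ENNReal.rpow_mul, mul_div_cancel₀ _ hP.ne', two_rpow_div_rpow hR]
  simp only [hpow] at hsub
  rw [← copSum] at hsub
  have h2 : (∑' k, y k ^ p.toReal) ^ (1 / p.toReal) ≤ copSum R ρ g ^ (1 / R) := by
    have := ENNReal.rpow_le_rpow hsub (show 0 ≤ 1 / R by positivity)
    rwa [← ENNReal.rpow_mul, show R / p.toReal * (1 / R) = 1 / p.toReal by field_simp] at this
  calc multInt p.toReal F g ^ (1 / p.toReal)
      ≤ (∑' k, A ^ p.toReal * y k ^ p.toReal) ^ (1 / p.toReal) := by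
        gcongr
        refine (multInt_le_tsum hp hp1 h hF hg).trans (ENNReal.tsum_le_tsum fun k => ?_)
        rw [← ENNReal.mul_rpow_of_nonneg _ _ hP.le, ← mul_assoc]
        gcongr
        exact hA k
    _ = A * (∑' k, y k ^ p.toReal) ^ (1 / p.toReal) := by
        rw [ENNReal.tsum_mul_left, ENNReal.mul_rpow_of_nonneg _ _ (by positivity),
          ← ENNReal.rpow_mul, mul_one_div_cancel hP.ne', ENNReal.rpow_one]
    _ ≤ _ := by gcongr

/-- Hölder is used twice: on each level, and then across levels with the cancelling weights
`2^(-k/R)` and `2^(k/R)`. -/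
lemma multInt_le_cesSum_mul (hp : 0 < p) (hp1 : p ≤ 1) {S R : ℝ} (hS : 0 < S) (hR : 0 < R)
    (hSR : 1 / p.toReal = 1 / S + 1 / R) (h : IsDensity ρ) (hF : AEMeasurable F halfLine)
    (hg : AEMeasurable g halfLine) :
    multInt p.toReal F g ^ (1 / p.toReal) ≤
      cesSum p S R ρ F ^ (1 / S) * copSum R ρ g ^ (1 / R) := by
  have hP : 0 < p.toReal := ENNReal.toReal_pos hp.ne' (hp1.trans_lt (by simp)).ne
  have hPS : p.toReal < S := by
    have : 0 < 1 / R := by positivity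
    exact (one_div_lt_one_div hS hP).1 (by linarith)
  have key := tsum_mul_rpow_le hP hPS hSR
    (fun k : ℤ => 2 ^ (-(k : ℝ) / R) * conjNorm p F (level ρ k))
    (fun k : ℤ => 2 ^ ((k : ℝ) / R) * ∫⁻ x in level ρ k, g x)
  have h1 : ∀ k : ℤ, ((2 : ℝ≥0∞) ^ (-(k : ℝ) / R) * conjNorm p F (level ρ k)) ^ S =
      2 ^ ((k : ℝ) * -(S / R)) * conjNorm p F (level ρ k) ^ S := fun k => by
    rw [ENNReal.mul_rpow_of_nonneg _ _ hS.le, ← ENNReal.rpow_mul]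
    congr 2
    ring
  have h2 : ∀ k : ℤ, (2 : ℝ≥0∞) ^ (-(k : ℝ) / R) * conjNorm p F (level ρ k) *
      (2 ^ ((k : ℝ) / R) * ∫⁻ x in level ρ k, g x) =
      conjNorm p F (level ρ k) * ∫⁻ x in level ρ k, g x := fun k => by
    rw [mul_mul_mul_comm, ← two_rpow_add]
    simp [neg_div]
  simp only [h1, h2, two_rpow_div_rpow hR] at key
  refine le_trans ?_ key
  gcongr
  exact multInt_le_tsum hp hp1 h hF hg

lemma exists_glue (ρ : ℝ → ℝ≥0∞) (f : ℤ → ℝ → ℝ≥0∞) (hf : ∀ k, Measurable (f k)) :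
    ∃ g : ℝ → ℝ≥0∞, Measurable g ∧ ∀ k, ∀ x ∈ level ρ k, g x = f k x := by
  refine ⟨fun x => ∑' j, (level ρ j).indicator (f j) x,
    Measurable.tsum fun j => (hf j).indicator (measurableSet_level ρ j), fun k x hx => ?_⟩
  beta_reduce
  rw [tsum_eq_single k, indicator_of_mem hx]
  intro j hj
  rw [indicator_of_notMem]
  exact fun hxj => Set.disjoint_left.1 (pairwise_disjoint_level ρ hj) hxj hx

/-- Test with a near-extremal function of integral one living on a single level: its dyadic Copson
sum is exactly `2^k`. -/
lemma exists_conjNorm_level_le (hp : 0 < p) (hp1 : p ≤ 1) {R : ℝ} (hR : 0 < R) :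
    ∃ C : ℝ≥0∞, C ≠ ∞ ∧ ∀ ρ : ℝ → ℝ≥0∞, IsDensity ρ → ∀ F : ℝ → ℝ≥0∞, AEMeasurable F halfLine →
      ∀ M : ℝ≥0∞, (∀ g : ℝ → ℝ≥0∞, Measurable g → copInt R ρ g < ∞ →
        multInt p.toReal F g ^ (1 / p.toReal) ≤ M * copInt R ρ g ^ (1 / R)) →
      ∀ k, conjNorm p F (level ρ k) ≤ C * M * 2 ^ ((k : ℝ) / R) := by
  have hP : 0 < p.toReal := ENNReal.toReal_pos hp.ne' (hp1.trans_lt (by simp)).ne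
  obtain ⟨C, hC, hcop⟩ := exists_copInt_le hR
  refine ⟨C ^ (1 / R), ENNReal.rpow_ne_top_of_nonneg (by positivity) hC,
    fun ρ h F hF M hM k => le_of_forall_lt_imp_le_of_dense fun a ha => ?_⟩
  obtain ⟨f, hfm, hf1, hfa⟩ := exists_near_extremal hp hp1 (aemeasurable_level hF k) ha
  obtain ⟨g, hgm, hg⟩ := exists_glue ρ (fun j => if j = k then f else 0) fun j => by
    split_ifs
    exacts [hfm, measurable_const]
  have hgk : ∀ x ∈ level ρ k, g x = f x := fun x hx => by simp [hg k x hx]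
  have hsum : copSum R ρ g = 2 ^ (k : ℝ) := by
    rw [copSum, tsum_eq_single k]
    · rw [setLIntegral_congr_fun (measurableSet_level ρ k) hgk, hf1, ENNReal.one_rpow, mul_one]
    · intro j hj
      rw [setLIntegral_congr_fun (measurableSet_level ρ j) (g := fun _ => 0)
        fun x hx => by simp [hg j x hx, hj]]
      simp [hR]
  have hle : copInt R ρ g ≤ C * 2 ^ (k : ℝ) := hsum ▸ hcop ρ h g
  have hlt : copInt R ρ g < ∞ :=
    hle.trans_lt (ENNReal.mul_lt_top hC.lt_top (two_rpow_ne_top _).lt_top)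
  calc a = (a ^ p.toReal) ^ (1 / p.toReal) := by
        rw [← ENNReal.rpow_mul, mul_one_div_cancel hP.ne', ENNReal.rpow_one]
    _ ≤ multInt p.toReal F g ^ (1 / p.toReal) := by
        gcongr
        refine hfa.trans ?_
        rw [setLIntegral_congr_fun (measurableSet_level ρ k)
          (g := fun x => (F x * g x) ^ p.toReal) fun x hx => by simp only [hgk x hx]]
        exact lintegral_mono_set (level_subset ρ k)
    _ ≤ M * copInt R ρ g ^ (1 / R) := hM g hgm hlt
    _ ≤ M * (C * 2 ^ (k : ℝ)) ^ (1 / R) := by gcongr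
    _ = _ := by
        rw [ENNReal.mul_rpow_of_nonneg _ _ (by positivity), ← ENNReal.rpow_mul, mul_one_div]
        ring

/-- Test with a finite combination of near-extremal functions, one per level, whose coefficients
give equality in the discrete Hölder inequality. -/
lemma exists_cesSum_le (hp : 0 < p) (hp1 : p ≤ 1) {S R : ℝ} (hS : 0 < S) (hR : 0 < R)
    (hSR : 1 / p.toReal = 1 / S + 1 / R) :
    ∃ C : ℝ≥0∞, C ≠ ∞ ∧ ∀ ρ : ℝ → ℝ≥0∞, IsDensity ρ → ∀ F : ℝ → ℝ≥0∞, AEMeasurable F halfLine →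
      ∀ M : ℝ≥0∞, (∀ g : ℝ → ℝ≥0∞, Measurable g → copInt R ρ g < ∞ →
        multInt p.toReal F g ^ (1 / p.toReal) ≤ M * copInt R ρ g ^ (1 / R)) →
      cesSum p S R ρ F ^ (1 / S) ≤ C * M := by
  classical
  have hP : 0 < p.toReal := ENNReal.toReal_pos hp.ne' (hp1.trans_lt (by simp)).ne
  obtain ⟨C', hC', hlev⟩ := exists_conjNorm_level_le hp hp1 hR
  obtain ⟨C, hC, hcop⟩ := exists_copInt_le hR
  -- The summand `1` only makes the constant nonzero, so that its product with `M = ∞` is `∞`.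
  refine ⟨2 * C ^ (1 / R) + 1, ENNReal.add_ne_top.2 ⟨ENNReal.mul_ne_top (by simp)
    (ENNReal.rpow_ne_top_of_nonneg (by positivity) hC), by simp⟩, fun ρ h F hF M hM => ?_⟩
  rcases eq_or_ne M ∞ with rfl | hMt
  · rw [ENNReal.mul_top (by simp)]
    exact le_top
  refine le_trans ?_ (mul_le_mul_left (le_self_add : 2 * C ^ (1 / R) ≤ _) M)
  set a : ℤ → ℝ≥0∞ := fun k => conjNorm p F (level ρ k)
  -- The single-level estimate makes every `a k` finite, so `a k / 2` is strictly below a nonzero `a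
  -- k` and a near-extremal function exists.
  have hat : ∀ k, a k ≠ ∞ := fun k => ne_top_of_le_ne_top (ENNReal.mul_ne_top
    (ENNReal.mul_ne_top hC' hMt) (two_rpow_ne_top _)) (hlev ρ h F hF M hM k)
  have hext : ∀ k, ∃ f : ℝ → ℝ≥0∞, Measurable f ∧ ∫⁻ x in level ρ k, f x ≤ 1 ∧
      (a k / 2) ^ p.toReal ≤ ∫⁻ x in level ρ k, (F x * f x) ^ p.toReal := by
    intro k
    rcases eq_or_ne (a k) 0 with h0 | h0
    · exact ⟨0, measurable_const, by simp, by simp [h0, hP]⟩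
    · obtain ⟨f, h1, h2, h3⟩ := exists_near_extremal hp hp1 (aemeasurable_level hF k)
        (ENNReal.half_lt_self h0 (hat k))
      exact ⟨f, h1, h2.le, h3⟩
  choose f hfm hf1 hfa using hext
  set A : ℤ → ℝ≥0∞ := fun k => 2 ^ ((k : ℝ) * -(S / R)) * a k ^ S
  have hAt : ∀ k, A k ≠ ∞ := fun k =>
    ENNReal.mul_ne_top (two_rpow_ne_top _) (ENNReal.rpow_ne_top_of_nonneg hS.le (hat k))
  rw [one_div, ENNReal.rpow_inv_le_iff hS, cesSum, ENNReal.tsum_eq_iSup_sum]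
  refine iSup_le fun J => ?_
  rw [← ENNReal.rpow_inv_le_iff hS, ← one_div]
  set σ := ∑ k ∈ J, A k with hσ
  rcases eq_or_ne σ 0 with hσ0 | hσ0
  · simp [hσ0, hS]
  have hσt : σ ≠ ∞ := ENNReal.sum_ne_top.2 fun k _ => hAt k
  -- Chosen so that `2^k (c k)^R` and `(c k * a k)^p` both equal `A k`; the second identity uses
  -- `1/p = 1/S + 1/R`.
  set c : ℤ → ℝ≥0∞ := fun k => 2 ^ (-(k : ℝ) / R) * A k ^ (1 / R)
  obtain ⟨g, hgm, hg⟩ := exists_glue ρ (fun k x => if k ∈ J then c k * f k x else 0) fun k => by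
    split_ifs
    exacts [(hfm k).const_mul _, measurable_const]
  have hsum : copSum R ρ g ≤ σ := by
    rw [copSum, tsum_eq_sum (s := J)]
    · refine Finset.sum_le_sum fun k hk => ?_
      rw [setLIntegral_congr_fun (measurableSet_level ρ k) (g := fun x => c k * f k x)
        fun x hx => by simp [hg k x hx, hk], lintegral_const_mul _ (hfm k)]
      calc (2 : ℝ≥0∞) ^ (k : ℝ) * (c k * ∫⁻ x in level ρ k, f k x) ^ R
          ≤ 2 ^ (k : ℝ) * (c k * 1) ^ R := by gcongr; exact hf1 k
        _ = A k := by
          rw [mul_one, ENNReal.mul_rpow_of_nonneg _ _ hR.le, ← ENNReal.rpow_mul,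
            ← ENNReal.rpow_mul, one_div_mul_cancel hR.ne', ENNReal.rpow_one,
            div_mul_cancel₀ _ hR.ne', ← mul_assoc, ← two_rpow_add]
          simp
    · intro k hk
      rw [setLIntegral_congr_fun (measurableSet_level ρ k) (g := fun _ => 0)
        fun x hx => by simp [hg k x hx, hk]]
      simp [hR]
  have hmult : (2⁻¹ : ℝ≥0∞) ^ p.toReal * σ ≤ multInt p.toReal F g := by
    rw [multInt, lintegral_eq_tsum_level h, hσ, Finset.mul_sum]
    refine le_trans (Finset.sum_le_sum fun k hk => ?_) (ENNReal.sum_le_tsum J)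
    have hfun : ∀ x ∈ level ρ k, (F x * g x) ^ p.toReal =
        c k ^ p.toReal * (F x * f k x) ^ p.toReal := fun x hx => by
      rw [hg k x hx, if_pos hk, mul_left_comm, ENNReal.mul_rpow_of_nonneg _ _ hP.le]
    have hfF : AEMeasurable (fun x => (F x * f k x) ^ p.toReal) (volume.restrict (level ρ k)) :=
      ((aemeasurable_level hF k).mul (hfm k).aemeasurable).pow_const _
    rw [setLIntegral_congr_fun (measurableSet_level ρ k) hfun, lintegral_const_mul'' _ hfF]
    refine le_trans (le_of_eq ?_) (mul_le_mul_right (hfa k) _)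
    have hbase : (2 : ℝ≥0∞) ^ (-(k : ℝ) / R) * a k = A k ^ (1 / S) := by
      rw [ENNReal.mul_rpow_of_nonneg _ _ (by positivity), ← ENNReal.rpow_mul,
        ← ENNReal.rpow_mul, mul_one_div_cancel hS.ne', ENNReal.rpow_one]
      congr 2
      field_simp
    have hAc : (c k * a k) ^ p.toReal = A k := by
      change (2 ^ (-(k : ℝ) / R) * A k ^ (1 / R) * a k) ^ p.toReal = A k
      rw [mul_right_comm, hbase, ← ENNReal.rpow_add_of_nonneg _ _ (by positivity) (by positivity),
        ← hSR, ← ENNReal.rpow_mul, one_div_mul_cancel hP.ne', ENNReal.rpow_one]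
    rw [← hAc, ← ENNReal.mul_rpow_of_nonneg _ _ hP.le, ← ENNReal.mul_rpow_of_nonneg _ _ hP.le,
      ENNReal.div_eq_inv_mul, mul_left_comm]
  have hle : copInt R ρ g ≤ C * σ := (hcop ρ h g).trans (by gcongr)
  have hlt : copInt R ρ g < ∞ := hle.trans_lt (ENNReal.mul_lt_top hC.lt_top hσt.lt_top)
  have hfin : 2⁻¹ * σ ^ (1 / p.toReal) ≤ M * (C ^ (1 / R) * σ ^ (1 / R)) := by
    calc 2⁻¹ * σ ^ (1 / p.toReal) = (2⁻¹ ^ p.toReal * σ) ^ (1 / p.toReal) := by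
          rw [ENNReal.mul_rpow_of_nonneg _ _ (by positivity), ← ENNReal.rpow_mul,
            mul_one_div_cancel hP.ne', ENNReal.rpow_one]
      _ ≤ multInt p.toReal F g ^ (1 / p.toReal) := by gcongr
      _ ≤ M * copInt R ρ g ^ (1 / R) := hM g hgm hlt
      _ ≤ M * (C * σ) ^ (1 / R) := by gcongr
      _ = _ := by rw [ENNReal.mul_rpow_of_nonneg _ _ (by positivity)]
  -- Now `σ^(1/p)` splits and `σ^(1/R)` cancels, which needs `σ` finite; hence the restriction to
  -- finite index sets.
  rw [hSR, ENNReal.rpow_add _ _ hσ0 hσt, ← mul_assoc, ← mul_assoc] at hfin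
  have hσR0 : σ ^ (1 / R) ≠ 0 := by simp [ENNReal.rpow_eq_zero_iff, hσ0, hσt]
  have hσRt : σ ^ (1 / R) ≠ ∞ := ENNReal.rpow_ne_top_of_nonneg (by positivity) hσt
  have hfin' := (ENNReal.mul_le_mul_iff_left hσR0 hσRt).1 hfin
  calc σ ^ (1 / S) = 2 * (2⁻¹ * σ ^ (1 / S)) := by
        rw [← mul_assoc, ENNReal.mul_inv_cancel (by simp) (by simp), one_mul]
    _ ≤ 2 * (M * C ^ (1 / R)) := by gcongr
    _ = _ := by ring

end CopCes

end

/-! ### Translation to the function spaces and the gliding hump -/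

noncomputable section

namespace CopCes

variable {p r : ℝ≥0∞} {u v w f g : ℝ → ℝ≥0∞}

lemma eLpNorm_eq_lintegral (hp : 0 < p) (hpt : p < ∞) (μ : Measure ℝ) (f : ℝ → ℝ≥0∞) :
    eLpNorm f p μ = (∫⁻ x, f x ^ p.toReal ∂μ) ^ (1 / p.toReal) := by
  rw [eLpNorm_eq_lintegral_rpow_enorm_toReal hp.ne' hpt.ne]
  rfl

lemma rpow_one_div_rpow {R : ℝ} (hR : 0 < R) (c : ℝ≥0∞) : (c ^ (1 / R)) ^ R = c := by
  rw [← ENNReal.rpow_mul, one_div_mul_cancel hR.ne', ENNReal.rpow_one]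

lemma rpow_rpow_one_div {R : ℝ} (hR : 0 < R) (c : ℝ≥0∞) : (c ^ R) ^ (1 / R) = c := by
  rw [← ENNReal.rpow_mul, mul_one_div_cancel hR.ne', ENNReal.rpow_one]

lemma rpow_one_div_lt_top_iff {R : ℝ} (hR : 0 < R) {c : ℝ≥0∞} : c ^ (1 / R) < ∞ ↔ c < ∞ :=
  ENNReal.rpow_lt_top_iff_of_pos (by positivity)

lemma isDensity_of_mem_dualOmega (hr : 0 < r) (hrt : r < ∞) (hu : u ∈ DualOmega r) :
    IsDensity fun x => u x ^ r.toReal := by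
  have hR : 0 < r.toReal := ENNReal.toReal_pos hr.ne' hrt.ne
  refine ⟨hu.1.pow_const _, fun t ht => ?_, fun t ht => ?_⟩
  · have := (hu.2 t ht).1
    rw [lnorm, eLpNorm_eq_lintegral hr hrt] at this
    refine pos_iff_ne_zero.2 fun h0 => this.ne' ?_
    rw [prim] at h0
    rw [h0, ENNReal.zero_rpow_of_pos (by positivity)]
  · have := (hu.2 t ht).2
    rwa [lnorm, eLpNorm_eq_lintegral hr hrt, rpow_one_div_lt_top_iff hR] at this

lemma lnorm_Ioi_eq (hr : 0 < r) (hrt : r < ∞) (u : ℝ → ℝ≥0∞) :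
    lnorm r (Ioi 0) u = totalMass (fun x => u x ^ r.toReal) ^ (1 / r.toReal) :=
  eLpNorm_eq_lintegral hr hrt _ _

lemma copOne_qnorm (hr : 0 < r) (hrt : r < ∞) (u g : ℝ → ℝ≥0∞) :
    (CopOne r u).qnorm g = copInt r.toReal (fun x => u x ^ r.toReal) g ^ (1 / r.toReal) := by
  have hR : 0 < r.toReal := ENNReal.toReal_pos hr.ne' hrt.ne
  change wnorm r u (Ioi 0) (fun t => wnorm 1 (fun _ => 1) (Ioi t) g) = _
  rw [wnorm, eLpNorm_eq_lintegral hr hrt, copInt]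
  congr 1
  refine lintegral_congr fun x => ?_
  rw [ENNReal.mul_rpow_of_nonneg _ _ hR.le, wnorm, eLpNorm_eq_lintegral one_pos (by simp)]
  simp

lemma mem_copOne (hr : 0 < r) (hrt : r < ∞) (u g : ℝ → ℝ≥0∞) :
    g ∈ (CopOne r u).carrier ↔
      AEMeasurable g halfLine ∧ copInt r.toReal (fun x => u x ^ r.toReal) g < ∞ := by
  have hR : 0 < r.toReal := ENNReal.toReal_pos hr.ne' hrt.ne
  change _ ∧ (CopOne r u).qnorm g < ∞ ↔ _
  rw [copOne_qnorm hr hrt, rpow_one_div_lt_top_iff hR]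
  rfl

/-- By Tonelli's theorem, the diagonal Cesàro functional is a weighted Lebesgue functional. -/
lemma ces_self_qnorm (hp : 0 < p) (hpt : p < ∞) (hv : AEMeasurable v halfLine)
    (hw : AEMeasurable w halfLine) (hf : AEMeasurable f halfLine) :
    (Ces p p w v).qnorm f =
      (∫⁻ x in Ioi (0 : ℝ), (f x * (opAStar p p w x * v x)) ^ p.toReal) ^ (1 / p.toReal) := by
  have hP : 0 < p.toReal := ENNReal.toReal_pos hp.ne' hpt.ne
  change wnorm p w (Ioi 0) (fun t => wnorm p v (Ioo 0 t) f) = _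
  rw [wnorm, eLpNorm_eq_lintegral hp hpt]
  congr 1
  set φ : ℝ → ℝ≥0∞ := fun x => (f x * v x) ^ p.toReal with hφ
  set ψ : ℝ → ℝ≥0∞ := fun t => w t ^ p.toReal with hψ
  have hφm : AEMeasurable φ halfLine := (hf.mul hv).pow_const _
  have hψm : AEMeasurable ψ halfLine := hw.pow_const _
  have hlt : MeasurableSet {z : ℝ × ℝ | z.2 < z.1} := measurableSet_lt measurable_snd measurable_fst
  calc ∫⁻ t in Ioi (0 : ℝ), (wnorm p v (Ioo 0 t) f * w t) ^ p.toReal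
      = ∫⁻ t, ∫⁻ x, {z : ℝ × ℝ | z.2 < z.1}.indicator (fun z => ψ z.1 * φ z.2) (t, x)
          ∂halfLine ∂halfLine := by
        refine lintegral_congr fun t => ?_
        rw [ENNReal.mul_rpow_of_nonneg _ _ hP.le, wnorm, eLpNorm_eq_lintegral hp hpt,
          rpow_one_div_rpow hP, mul_comm]
        have hset : volume.restrict (Ioo 0 t) = halfLine.restrict (Iio t) := by
          rw [halfLine, Measure.restrict_restrict measurableSet_Iio]
          congr 1
          ext x
          simp [and_comm]
        rw [hset, ← lintegral_const_mul'' _ (hφm.mono_measure Measure.restrict_le_self),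
          ← lintegral_indicator measurableSet_Iio]
        rfl
    _ = ∫⁻ x, ∫⁻ t, {z : ℝ × ℝ | z.2 < z.1}.indicator (fun z => ψ z.1 * φ z.2) (t, x)
          ∂halfLine ∂halfLine := by
        have : SFinite halfLine := by unfold halfLine; infer_instance
        exact lintegral_lintegral_swap
          (((hψm.comp_fst).mul (hφm.comp_snd)).indicator hlt)
    _ = _ := by
        refine setLIntegral_congr_fun measurableSet_Ioi fun x hx => ?_
        have hset : volume.restrict (Ioi x) = halfLine.restrict (Ioi x) := by
          rw [halfLine, Measure.restrict_restrict measurableSet_Ioi,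
            inter_eq_left.2 (Ioi_subset_Ioi (le_of_lt hx))]
        have hψx : AEMeasurable ψ (halfLine.restrict (Ioi x)) :=
          hψm.mono_measure Measure.restrict_le_self
        have hA : opAStar p p w x = (∫⁻ t in Ioi x, ψ t) ^ (1 / p.toReal) := by
          simp [opAStar, hψ]
        rw [hA, mul_left_comm, ENNReal.mul_rpow_of_nonneg _ _ hP.le, rpow_one_div_rpow hP, hset,
          ← lintegral_mul_const'' _ hψx, ← lintegral_indicator measurableSet_Ioi]
        rfl

lemma aemeasurable_opAStar_mul (hv : AEMeasurable v halfLine) :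
    AEMeasurable (fun x => opAStar p p w x * v x) halfLine := by
  have hanti : Antitone fun x : ℝ => ∫⁻ t in Ioi x, w t ^ p.toReal :=
    fun a b hab => lintegral_mono_set (Ioi_subset_Ioi hab)
  simp only [opAStar, sub_self, zero_div, ENNReal.rpow_zero, mul_one]
  exact (hanti.measurable.pow_const _).aemeasurable.mul hv

lemma ces_self_qnorm_mul (hp : 0 < p) (hpt : p < ∞) (hv : AEMeasurable v halfLine)
    (hw : AEMeasurable w halfLine) (hf : AEMeasurable f halfLine) (hg : AEMeasurable g halfLine) :
    (Ces p p w v).qnorm (fun x => f x * g x) =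
      multInt p.toReal (fun x => f x * (opAStar p p w x * v x)) g ^ (1 / p.toReal) := by
  rw [ces_self_qnorm (f := fun x => f x * g x) hp hpt hv hw (hf.mul hg), multInt]
  simp only [mul_right_comm]

lemma ces_top_qnorm (p r : ℝ≥0∞) (u ω f : ℝ → ℝ≥0∞) :
    (Ces (conjExp p) ∞ (opA r r u) ω).qnorm f =
      essSup (fun t => conjNorm p (fun x => f x * ω x) (Ioo 0 t) *
        prim (fun x => u x ^ r.toReal) t ^ (-(1 / r.toReal))) halfLine := by
  change eLpNorm (fun t => _ * opA r r u t) ∞ _ = _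
  simp only [opA, sub_self, zero_div, ENNReal.rpow_zero, mul_one]
  rw [eLpNorm_exponent_top]
  rfl

lemma arrow_toReal (hp : 0 < p) (hrt : r < ∞) (hpr : p < r) :
    0 < (arrow r p).toReal ∧ arrow r p < ∞ ∧
      1 / p.toReal = 1 / (arrow r p).toReal + 1 / r.toReal := by
  have hle : r⁻¹ < p⁻¹ := ENNReal.inv_lt_inv.2 hpr
  have hpi : p⁻¹ ≠ ∞ := ENNReal.inv_ne_top.2 hp.ne'
  have h1 : (arrow r p).toReal = (p.toReal⁻¹ - r.toReal⁻¹)⁻¹ := by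
    rw [arrow, if_pos hpr, ENNReal.toReal_inv, ENNReal.toReal_sub_of_le hle.le hpi,
      ENNReal.toReal_inv, ENNReal.toReal_inv]
  have hP : 0 < p.toReal := ENNReal.toReal_pos hp.ne' (hpr.trans hrt).ne
  have hPR : p.toReal < r.toReal := (ENNReal.toReal_lt_toReal (hpr.trans hrt).ne hrt.ne).2 hpr
  have h2 : 0 < p.toReal⁻¹ - r.toReal⁻¹ := sub_pos.2 (inv_strictAnti₀ hP hPR)
  refine ⟨by rw [h1]; positivity, ?_, by rw [h1]; simp⟩
  rw [arrow, if_pos hpr, ENNReal.inv_lt_top]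
  exact tsub_pos_of_lt hle

lemma ces_arrow_qnorm (hp : 0 < p) (hrt : r < ∞) (hpr : p < r) (u ω f : ℝ → ℝ≥0∞) :
    (Ces (conjExp p) (arrow r p) (opA r p u) ω).qnorm f =
      cesInt p (arrow r p).toReal r.toReal (fun x => u x ^ r.toReal) (fun x => f x * ω x) ^
        (1 / (arrow r p).toReal) := by
  obtain ⟨hS, hSt, hSR⟩ := arrow_toReal hp hrt hpr
  have hP : 0 < p.toReal := ENNReal.toReal_pos hp.ne' (hpr.trans hrt).ne
  have hR : 0 < r.toReal := ENNReal.toReal_pos (hp.trans hpr).ne' hrt.ne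
  have hS0 : 0 < arrow r p := (ENNReal.toReal_pos_iff.1 hS).1
  set S := (arrow r p).toReal with hSdef
  -- This identity turns the `S`-th power of `opA r p u` into the weight `prim^(-(1 + S/r)) u^r` of
  -- `cesInt`.
  have hSP : S / p.toReal = 1 + S / r.toReal := by
    rw [div_eq_mul_one_div, hSR, mul_add, mul_one_div_cancel hS.ne', ← div_eq_mul_one_div]
  change eLpNorm (fun t => conjNorm p (fun x => f x * ω x) (Ioo 0 t) * opA r p u t) _ _ = _
  rw [eLpNorm_eq_lintegral hS0 hSt, ← hSdef, cesInt]
  congr 1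
  refine lintegral_congr fun t => ?_
  rw [opA, ENNReal.mul_rpow_of_nonneg _ _ hS.le, ENNReal.mul_rpow_of_nonneg _ _ hS.le,
    ← ENNReal.rpow_mul, ← ENNReal.rpow_mul, ← prim]
  congr 3
  · rw [← hSP]; ring
  · have : r.toReal * (S / p.toReal) - S = r.toReal := by
      rw [hSP]; field_simp; ring
    calc (r.toReal - p.toReal) / p.toReal * S = r.toReal * (S / p.toReal) - S := by field_simp
      _ = r.toReal := this

lemma endTerm_eq (hr : 0 < r) (hrt : r < ∞) (u ω f : ℝ → ℝ≥0∞) :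
    endTerm p r.toReal (fun x => u x ^ r.toReal) (fun x => f x * ω x) =
      (lnorm r (Ioi 0) u)⁻¹ * wnorm (conjExp p) ω (Ioi 0) f := by
  rw [lnorm_Ioi_eq hr hrt]
  rfl

lemma ae_eq_zero_of_copInt_eq_zero {ρ : ℝ → ℝ≥0∞} {R : ℝ} (h : IsDensity ρ) (hR : 0 < R)
    (hg : AEMeasurable g halfLine) (h0 : copInt R ρ g = 0) : g =ᵐ[halfLine] fun _ => 0 := by
  have h1 := h.copSum_le hR g
  rw [h0, mul_zero, le_zero_iff, copSum, ENNReal.tsum_eq_zero] at h1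
  have h2 : ∫⁻ x in Ioi (0 : ℝ), g x = 0 := by
    rw [lintegral_eq_tsum_level h, ENNReal.tsum_eq_zero]
    intro k
    rcases mul_eq_zero.1 (h1 k) with h3 | h3
    · exact absurd h3 (two_rpow_pos _)
    · exact ((ENNReal.rpow_eq_zero_iff_of_pos hR).1 h3)
  exact (lintegral_eq_zero_iff' hg).1 h2

lemma mult_qnorm_le {X Y : FunSpace} {K : ℝ≥0∞}
    (h : ∀ g ∈ X.carrier, Y.qnorm (fun x => f x * g x) ≤ K * X.qnorm g) :
    (Mult X Y).qnorm f ≤ K :=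
  iSup₂_le fun g hg => ENNReal.div_le_of_le_mul (h g hg.1)

/-- The supremum of quotients becomes an inequality for all `g`: null `g` make the left side zero,
and all others have a nonzero finite denominator. -/
lemma le_mult_qnorm (hp : 0 < p) (hpt : p < ∞) (hr : 0 < r) (hrt : r < ∞) (hu : u ∈ DualOmega r)
    (hv : AEMeasurable v halfLine) (hw : AEMeasurable w halfLine) (hf : AEMeasurable f halfLine)
    (hg : g ∈ (CopOne r u).carrier) :
    multInt p.toReal (fun x => f x * (opAStar p p w x * v x)) g ^ (1 / p.toReal) ≤
      (Mult (CopOne r u) (Ces p p w v)).qnorm f *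
        copInt r.toReal (fun x => u x ^ r.toReal) g ^ (1 / r.toReal) := by
  have hP : 0 < p.toReal := ENNReal.toReal_pos hp.ne' hpt.ne
  have hR : 0 < r.toReal := ENNReal.toReal_pos hr.ne' hrt.ne
  have hg' := (mem_copOne hr hrt u g).1 hg
  by_cases h0 : g =ᵐ[halfLine] fun _ => 0
  · have : multInt p.toReal (fun x => f x * (opAStar p p w x * v x)) g = 0 := by
      rw [multInt, ← lintegral_zero (μ := volume.restrict (Ioi (0 : ℝ)))]
      refine lintegral_congr_ae ?_
      filter_upwards [h0] with x hx
      simp [hx, hP]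
    rw [this, ENNReal.zero_rpow_of_pos (by positivity)]
    exact zero_le
  · have hle : (Ces p p w v).qnorm (fun x => f x * g x) / (CopOne r u).qnorm g ≤
        (Mult (CopOne r u) (Ces p p w v)).qnorm f :=
      le_iSup₂ (f := fun g (_ : g ∈ {g | g ∈ (CopOne r u).carrier ∧ ¬ g =ᵐ[halfLine] fun _ => 0}) =>
        (Ces p p w v).qnorm (fun x => f x * g x) / (CopOne r u).qnorm g) g ⟨hg, h0⟩
    rw [ces_self_qnorm_mul hp hpt hv hw hf hg'.1, copOne_qnorm hr hrt] at hle
    refine (ENNReal.div_le_iff ?_ ?_).1 hle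
    · intro h1
      refine h0 (ae_eq_zero_of_copInt_eq_zero (isDensity_of_mem_dualOmega hr hrt hu) hR hg'.1 ?_)
      exact (ENNReal.rpow_eq_zero_iff_of_pos (by positivity)).1 h1
    · exact ((rpow_one_div_lt_top_iff hR).2 hg'.2).ne

lemma copInt_const_mul {R : ℝ} (hR : 0 < R) {c : ℝ≥0∞} (hc : c ≠ ∞) (ρ g : ℝ → ℝ≥0∞) :
    copInt R ρ (fun x => c * g x) = c ^ R * copInt R ρ g := by
  rw [copInt, copInt, ← lintegral_const_mul' _ _ (ENNReal.rpow_ne_top_of_nonneg hR.le hc)]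
  refine lintegral_congr fun x => ?_
  rw [lintegral_const_mul' _ _ hc, ENNReal.mul_rpow_of_nonneg _ _ hR.le, mul_assoc]

lemma multInt_const_mul {P : ℝ} (hP : 0 < P) {c : ℝ≥0∞} (hc : c ≠ ∞) (F g : ℝ → ℝ≥0∞) :
    multInt P F (fun x => c * g x) = c ^ P * multInt P F g := by
  rw [multInt, multInt, ← lintegral_const_mul' _ _ (ENNReal.rpow_ne_top_of_nonneg hP.le hc)]
  refine lintegral_congr fun x => ?_
  rw [mul_left_comm, ENNReal.mul_rpow_of_nonneg _ _ hP.le]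

/-- A substitute for the countable triangle inequality that is also valid for `R < 1`, at the price
of the weights `2^(nR)`. -/
lemma copInt_tsum_le {ρ : ℝ → ℝ≥0∞} (h : IsDensity ρ) {R : ℝ} (hR : 0 < R)
    (g : ℕ → ℝ → ℝ≥0∞) (hg : ∀ n, AEMeasurable (g n) halfLine) :
    copInt R ρ (fun x => ∑' n, g n x) ≤ (∑' n : ℕ, (2 : ℝ≥0∞) ^ ((n : ℝ) * -1)) ^ R *
      ∑' n : ℕ, (2 : ℝ≥0∞) ^ ((n : ℝ) * R) * copInt R ρ (g n) := by
  have hanti : ∀ n, Antitone fun x : ℝ => ∫⁻ y in Ioi x, g n y :=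
    fun n a b hab => lintegral_mono_set (Ioi_subset_Ioi hab)
  have hm : ∀ n, AEMeasurable (fun x => (∫⁻ y in Ioi x, g n y) ^ R * ρ x)
      (volume.restrict (Ioi (0 : ℝ))) := fun n =>
    ((hanti n).measurable.pow_const R).aemeasurable.mul h.aemeasurable
  have hmt : AEMeasurable (fun x => ∑' n : ℕ, (2 : ℝ≥0∞) ^ ((n : ℝ) * R) *
      ((∫⁻ y in Ioi x, g n y) ^ R * ρ x)) (volume.restrict (Ioi (0 : ℝ))) :=
    AEMeasurable.tsum fun n => (hm n).const_mul _
  simp only [copInt]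
  simp_rw [← lintegral_const_mul'' _ (hm _)]
  rw [← lintegral_tsum fun n => (hm n).const_mul _, ← lintegral_const_mul'' _ hmt]
  refine setLIntegral_mono' measurableSet_Ioi fun x hx => ?_
  rw [lintegral_tsum fun n => (hg n).mono_measure
    (Measure.restrict_mono (Ioi_subset_Ioi (le_of_lt hx)) le_rfl)]
  refine (mul_le_mul_left (rpow_tsum_le (δ := 1) hR _) _).trans_eq ?_
  rw [mul_assoc, ← ENNReal.tsum_mul_right]
  simp only [one_mul, mul_assoc]

/-- A gliding hump argument: multipliers have a finite multiplier functional. -/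
lemma mult_carrier_eq (hp : 0 < p) (hpt : p < ∞) (hr : 0 < r) (hrt : r < ∞) (hu : u ∈ DualOmega r)
    (hv : AEMeasurable v halfLine) (hw : AEMeasurable w halfLine) :
    (Mult (CopOne r u) (Ces p p w v)).carrier =
      {f | f ∈ MeasPos ∧ (Mult (CopOne r u) (Ces p p w v)).qnorm f < ∞} := by
  have hP : 0 < p.toReal := ENNReal.toReal_pos hp.ne' hpt.ne
  have hR : 0 < r.toReal := ENNReal.toReal_pos hr.ne' hrt.ne
  have hρ := isDensity_of_mem_dualOmega hr hrt hu
  ext f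
  constructor
  · rintro ⟨hf, hfg⟩
    refine ⟨hf, ?_⟩
    by_contra hinf
    rw [not_lt, top_le_iff] at hinf
    set F : ℝ → ℝ≥0∞ := fun x => f x * (opAStar p p w x * v x) with hF
    set ρ : ℝ → ℝ≥0∞ := fun x => u x ^ r.toReal with hρdef
    -- The humps have norm at most `2^(-2n)`, small enough to absorb the weights `2^(nr)` of
    -- `copInt_tsum_le`, while their images have norm at least `n`.
    have hump : ∀ n : ℕ, ∃ g : ℝ → ℝ≥0∞, AEMeasurable g halfLine ∧
        copInt r.toReal ρ g ≤ 2 ^ ((n : ℝ) * -(2 * r.toReal)) ∧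
        (n : ℝ≥0∞) ≤ multInt p.toReal F g ^ (1 / p.toReal) := by
      intro n
      have hK : (2 : ℝ≥0∞) ^ (2 * (n : ℝ)) * n < (Mult (CopOne r u) (Ces p p w v)).qnorm f := by
        rw [hinf]
        exact ENNReal.mul_lt_top (two_rpow_ne_top _).lt_top (by simp)
      simp only [Mult, lt_iSup_iff] at hK
      obtain ⟨g, ⟨hgX, hg0⟩, hK⟩ := hK
      have hg' := (mem_copOne hr hrt u g).1 hgX
      rw [ces_self_qnorm_mul hp hpt hv hw hf hg'.1, copOne_qnorm hr hrt, ← hρdef] at hK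
      set N := copInt r.toReal ρ g ^ (1 / r.toReal) with hN
      have hN0 : N ≠ 0 := fun h1 => hg0 (ae_eq_zero_of_copInt_eq_zero hρ hR hg'.1
        ((ENNReal.rpow_eq_zero_iff_of_pos (by positivity)).1 h1))
      have hNt : N ≠ ∞ := ((rpow_one_div_lt_top_iff hR).2 hg'.2).ne
      have hc : N⁻¹ * (2 : ℝ≥0∞) ^ (-(2 * (n : ℝ))) ≠ ∞ :=
        ENNReal.mul_ne_top (ENNReal.inv_ne_top.2 hN0) (two_rpow_ne_top _)
      refine ⟨fun x => N⁻¹ * 2 ^ (-(2 * (n : ℝ))) * g x, hg'.1.const_mul _, ?_, ?_⟩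
      · have hNR : copInt r.toReal ρ g = N ^ r.toReal := (rpow_one_div_rpow hR _).symm
        rw [copInt_const_mul hR hc, hNR, ← ENNReal.mul_rpow_of_nonneg _ _ hR.le,
          mul_right_comm, ENNReal.inv_mul_cancel hN0 hNt, one_mul, ← ENNReal.rpow_mul]
        exact le_of_eq (by congr 1; ring)
      · rw [multInt_const_mul hP hc, ENNReal.mul_rpow_of_nonneg _ _ (by positivity),
          rpow_rpow_one_div hP]
        calc (n : ℝ≥0∞) = 2 ^ (-(2 * (n : ℝ))) * (2 ^ (2 * (n : ℝ)) * n) := by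
              rw [← mul_assoc, ← two_rpow_add]; simp
          _ ≤ 2 ^ (-(2 * (n : ℝ))) * (multInt p.toReal F g ^ (1 / p.toReal) / N) := by
              gcongr
          _ = _ := by rw [ENNReal.div_eq_inv_mul]; ring
    choose g hgm hgc hgn using hump
    have hsum : copInt r.toReal ρ (fun x => ∑' n, g n x) < ∞ := by
      refine (copInt_tsum_le hρ hR g hgm).trans_lt (ENNReal.mul_lt_top ?_ ?_)
      · exact (ENNReal.rpow_ne_top_of_nonneg hR.le
          (tsum_geometric_rpow_ne_top (by norm_num))).lt_top
      · refine lt_of_le_of_lt ?_ (tsum_geometric_rpow_ne_top (neg_lt_zero.2 hR)).lt_top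
        refine ENNReal.tsum_le_tsum fun n => (mul_le_mul_right (hgc n) _).trans_eq ?_
        rw [← two_rpow_add]
        congr 1
        ring
    have hgm' : AEMeasurable (fun x => ∑' n, g n x) halfLine := AEMeasurable.tsum hgm
    have hY := (hfg _ ((mem_copOne hr hrt u _).2 ⟨hgm', hsum⟩)).2
    change (Ces p p w v).qnorm _ < ∞ at hY
    rw [ces_self_qnorm_mul hp hpt hv hw hf hgm', ← hF] at hY
    obtain ⟨n, hn⟩ := ENNReal.exists_nat_gt hY.ne
    -- By positivity the sum dominates each hump, so its image has norm at least `n` for every `n`.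
    refine absurd hn (not_lt.2 ((hgn n).trans ?_))
    refine ENNReal.rpow_le_rpow (lintegral_mono fun x => ?_) (by positivity)
    gcongr
    exact ENNReal.le_tsum n
  · rintro ⟨hf, hfin⟩
    refine ⟨hf, fun g hg => ?_⟩
    have hg' := (mem_copOne hr hrt u g).1 hg
    refine ⟨hf.mul hg'.1, ?_⟩
    change (Ces p p w v).qnorm _ < ∞
    rw [ces_self_qnorm_mul hp hpt hv hw hf hg'.1]
    exact (le_mult_qnorm hp hpt hr hrt hu hv hw hf hg).trans_lt
      (ENNReal.mul_lt_top hfin ((rpow_one_div_lt_top_iff hR).2 hg'.2))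

lemma FunSpace.Same.of_le {X Y : FunSpace} (hX : X.carrier = {f | f ∈ MeasPos ∧ X.qnorm f < ∞})
    (hY : Y.carrier = {f | f ∈ MeasPos ∧ Y.qnorm f < ∞}) {C : ℝ≥0∞} (hC : C ≠ ∞)
    (h : ∀ f ∈ MeasPos, X.qnorm f ≤ C * Y.qnorm f ∧ Y.qnorm f ≤ C * X.qnorm f) : X.Same Y := by
  refine ⟨?_, C.toNNReal, fun f hf => ?_⟩
  · rw [hX, hY]
    ext f
    exact ⟨fun hf => ⟨hf.1, (h f hf.1).2.trans_lt (ENNReal.mul_lt_top hC.lt_top hf.2)⟩,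
      fun hf => ⟨hf.1, (h f hf.1).1.trans_lt (ENNReal.mul_lt_top hC.lt_top hf.2)⟩⟩
  · rw [ENNReal.coe_toNNReal hC]
    rw [hX] at hf
    exact h f hf.1

/-- The two-sided estimate of the multiplier functional for `r ≤ p`. -/
lemma exists_mult_equiv_of_le (hp : 0 < p) (hp1 : p ≤ 1) (hr : 0 < r) (hrp : r ≤ p) :
    ∃ C : ℝ≥0, ∀ u v w : ℝ → ℝ≥0∞, v ∈ Weight → u ∈ DualOmega r → w ∈ Omega p →
      ∀ f ∈ MeasPos,
        (Mult (CopOne r u) (Ces p p w v)).qnorm f ≤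
          C * (Ces (conjExp p) ∞ (opA r r u) fun x => opAStar p p w x * v x).qnorm f ∧
        (Ces (conjExp p) ∞ (opA r r u) fun x => opAStar p p w x * v x).qnorm f ≤
          C * (Mult (CopOne r u) (Ces p p w v)).qnorm f := by
  have hpt : p < ∞ := hp1.trans_lt (by simp)
  have hrt : r < ∞ := hrp.trans_lt hpt
  have hR : 0 < r.toReal := ENNReal.toReal_pos hr.ne' hrt.ne
  have hRP : r.toReal ≤ p.toReal := ENNReal.toReal_mono hpt.ne hrp
  obtain ⟨C₁, hC₁, h₁⟩ := exists_conjNorm_level_le hp hp1 hR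
  obtain ⟨C₂, hC₂, h₂⟩ := exists_conjNorm_Ioo_le hp hp1 hR
  -- The factors come from `conjNorm_level_le_of_ae` and `IsDensity.copSum_le`.
  set C₀ : ℝ≥0∞ := 2 ^ (2 / r.toReal) * 2 ^ (1 / r.toReal)
  have hC₀ : C₀ ≠ ∞ := ENNReal.mul_ne_top (two_rpow_ne_top _) (two_rpow_ne_top _)
  have hC : C₀ + C₂ * C₁ ≠ ∞ := ENNReal.add_ne_top.2 ⟨hC₀, ENNReal.mul_ne_top hC₂ hC₁⟩
  refine ⟨(C₀ + C₂ * C₁).toNNReal, fun u v w hv hu hw f hf => ?_⟩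
  rw [ENNReal.coe_toNNReal hC, ces_top_qnorm]
  have hρ := isDensity_of_mem_dualOmega hr hrt hu
  set ρ : ℝ → ℝ≥0∞ := fun x => u x ^ r.toReal with hρdef
  set F : ℝ → ℝ≥0∞ := fun x => f x * (opAStar p p w x * v x) with hF
  have hFm : AEMeasurable F halfLine := hf.mul (aemeasurable_opAStar_mul hv.1)
  set D := essSup (fun t => conjNorm p F (Ioo 0 t) * prim ρ t ^ (-(1 / r.toReal))) halfLine
  have hprim : ∀ t, 0 < t → prim ρ t ^ (1 / r.toReal) ≠ 0 ∧ prim ρ t ^ (1 / r.toReal) ≠ ∞ :=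
    fun t ht => ⟨fun h0 => (hρ.pos t ht).ne' ((ENNReal.rpow_eq_zero_iff_of_pos
      (by positivity)).1 h0), ((rpow_one_div_lt_top_iff hR).2 (hρ.lt_top t ht)).ne⟩
  constructor
  · refine le_trans ?_ (mul_le_mul_left (le_self_add : C₀ ≤ _) _)
    refine mult_qnorm_le fun g hg => ?_
    have hg' := (mem_copOne hr hrt u g).1 hg
    rw [ces_self_qnorm_mul hp hpt hv.1 hw.1 hf hg'.1, copOne_qnorm hr hrt]
    have hD : ∀ᵐ t ∂halfLine, conjNorm p F (Ioo 0 t) ≤ D * prim ρ t ^ (1 / r.toReal) := by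
      filter_upwards [ENNReal.ae_le_essSup (μ := halfLine)
        (fun t => conjNorm p F (Ioo 0 t) * prim ρ t ^ (-(1 / r.toReal))),
        ae_restrict_mem measurableSet_Ioi] with t ht ht0
      rw [ENNReal.rpow_neg, ← div_eq_mul_inv] at ht
      exact (ENNReal.div_le_iff (hprim t ht0).1 (hprim t ht0).2).1 ht
    refine (multInt_le_of_le hp hp1 hR hRP hρ hFm hg'.1
      (conjNorm_level_le_of_ae hp hp1 hρ hR hD)).trans ?_
    calc 2 ^ (2 / r.toReal) * D * copSum r.toReal ρ g ^ (1 / r.toReal)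
        ≤ 2 ^ (2 / r.toReal) * D * (2 * copInt r.toReal ρ g) ^ (1 / r.toReal) := by
          gcongr
          exact hρ.copSum_le hR g
      _ = _ := by
          rw [ENNReal.mul_rpow_of_nonneg _ _ (by positivity)]
          ring
  · refine le_trans ?_ (mul_le_mul_left (le_add_self : C₂ * C₁ ≤ _) _)
    have hlev := h₁ ρ hρ F hFm _ fun g hgm hgc =>
      le_mult_qnorm hp hpt hr hrt hu hv.1 hw.1 hf
        ((mem_copOne hr hrt u g).2 ⟨hgm.aemeasurable, hgc⟩)
    refine essSup_le_of_ae_le _ ?_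
    filter_upwards [ae_restrict_mem measurableSet_Ioi] with t ht0
    rw [ENNReal.rpow_neg, ← div_eq_mul_inv,
      ENNReal.div_le_iff (hprim t ht0).1 (hprim t ht0).2, mul_assoc C₂]
    exact h₂ ρ hρ F _ hlev t ht0

/-- The two-sided estimate of the multiplier functional for `p < r`. -/
lemma exists_mult_equiv_of_lt (hp : 0 < p) (hp1 : p ≤ 1) (hrt : r < ∞) (hpr : p < r) :
    ∃ C : ℝ≥0, ∀ u v w : ℝ → ℝ≥0∞, v ∈ Weight → u ∈ DualOmega r → w ∈ Omega p →
      ∀ f ∈ MeasPos,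
        (Mult (CopOne r u) (Ces p p w v)).qnorm f ≤
          C * ((Ces (conjExp p) (arrow r p) (opA r p u)
            fun x => opAStar p p w x * v x).qnorm f +
            (lnorm r (Ioi 0) u)⁻¹ *
              wnorm (conjExp p) (fun x => opAStar p p w x * v x) (Ioi 0) f) ∧
        (Ces (conjExp p) (arrow r p) (opA r p u) fun x => opAStar p p w x * v x).qnorm f +
            (lnorm r (Ioi 0) u)⁻¹ *
              wnorm (conjExp p) (fun x => opAStar p p w x * v x) (Ioi 0) f ≤
          C * (Mult (CopOne r u) (Ces p p w v)).qnorm f := by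
  have hpt : p < ∞ := hp1.trans_lt (by simp)
  have hr : 0 < r := hp.trans hpr
  have hR : 0 < r.toReal := ENNReal.toReal_pos hr.ne' hrt.ne
  obtain ⟨hS, hSt, hSR⟩ := arrow_toReal hp hrt hpr
  set S := (arrow r p).toReal with hSdef
  have hS1 : 0 ≤ 1 / S := by positivity
  obtain ⟨C₁, hC₁, h₁⟩ := exists_cesSum_le hp hp1 hS hR hSR
  obtain ⟨C₂, hC₂, h₂⟩ := exists_le_cesSum hp hp1 hS hR
  -- The sum of the two coefficients in `cesSum_le`.
  set c : ℝ≥0∞ := 2 ^ (1 + 2 * (S / r.toReal)) + 2 * 2 ^ (2 * (S / r.toReal))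
  have hc : c ≠ ∞ := ENNReal.add_ne_top.2
    ⟨two_rpow_ne_top _, ENNReal.mul_ne_top (by simp) (two_rpow_ne_top _)⟩
  set C₀ : ℝ≥0∞ := c ^ (1 / S) * 2 ^ (1 / r.toReal)
  set C₃ : ℝ≥0∞ := 2 * (C₂ ^ (1 / S) * C₁)
  have hC : C₀ + C₃ ≠ ∞ := ENNReal.add_ne_top.2
    ⟨ENNReal.mul_ne_top (ENNReal.rpow_ne_top_of_nonneg hS1 hc) (two_rpow_ne_top _),
      ENNReal.mul_ne_top (by simp)
        (ENNReal.mul_ne_top (ENNReal.rpow_ne_top_of_nonneg hS1 hC₂) hC₁)⟩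
  refine ⟨(C₀ + C₃).toNNReal, fun u v w hv hu hw f hf => ?_⟩
  rw [ENNReal.coe_toNNReal hC, ces_arrow_qnorm hp hrt hpr, ← endTerm_eq hr hrt, ← hSdef]
  have hρ := isDensity_of_mem_dualOmega hr hrt hu
  set ρ : ℝ → ℝ≥0∞ := fun x => u x ^ r.toReal with hρdef
  set F : ℝ → ℝ≥0∞ := fun x => f x * (opAStar p p w x * v x) with hF
  have hFm : AEMeasurable F halfLine := hf.mul (aemeasurable_opAStar_mul hv.1)
  set I := cesInt p S r.toReal ρ F with hI
  set E := endTerm p r.toReal ρ F with hE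
  constructor
  · refine le_trans ?_ (mul_le_mul_left (le_self_add : C₀ ≤ _) _)
    refine mult_qnorm_le fun g hg => ?_
    have hg' := (mem_copOne hr hrt u g).1 hg
    rw [ces_self_qnorm_mul hp hpt hv.1 hw.1 hf hg'.1, copOne_qnorm hr hrt]
    have hsum : cesSum p S r.toReal ρ F ≤ c * (I ^ (1 / S) + E) ^ S := by
      refine (cesSum_le hρ hS hR F).trans ?_
      rw [← mul_assoc, add_mul]
      gcongr
      · calc I = (I ^ (1 / S)) ^ S := (rpow_one_div_rpow hS I).symm
          _ ≤ _ := by gcongr; exact le_self_add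
      · exact le_add_self
    refine (multInt_le_cesSum_mul hp hp1 hS hR hSR hρ hFm hg'.1).trans ?_
    calc cesSum p S r.toReal ρ F ^ (1 / S) * copSum r.toReal ρ g ^ (1 / r.toReal)
        ≤ (c * (I ^ (1 / S) + E) ^ S) ^ (1 / S) *
            (2 * copInt r.toReal ρ g) ^ (1 / r.toReal) := by
          gcongr
          exact hρ.copSum_le hR g
      _ = _ := by
          rw [ENNReal.mul_rpow_of_nonneg _ _ (by positivity), rpow_rpow_one_div hS,
            ENNReal.mul_rpow_of_nonneg _ _ (by positivity)]
          ring
  · refine le_trans ?_ (mul_le_mul_left (le_add_self : C₃ ≤ _) _)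
    have hsum := h₁ ρ hρ F hFm _ fun g hgm hgc =>
      le_mult_qnorm hp hpt hr hrt hu hv.1 hw.1 hf
        ((mem_copOne hr hrt u g).2 ⟨hgm.aemeasurable, hgc⟩)
    set M := (Mult (CopOne r u) (Ces p p w v)).qnorm f
    have hroot : (C₂ * cesSum p S r.toReal ρ F) ^ (1 / S) ≤ C₂ ^ (1 / S) * C₁ * M := by
      rw [ENNReal.mul_rpow_of_nonneg _ _ hS1, mul_assoc]
      gcongr
    rw [mul_assoc 2, two_mul]
    refine add_le_add ?_ ?_
    · exact (ENNReal.rpow_le_rpow (h₂ ρ hρ F).1 hS1).trans hroot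
    · rw [← rpow_rpow_one_div hS E]
      exact (ENNReal.rpow_le_rpow (h₂ ρ hρ F).2 hS1).trans hroot

end CopCes

end

/-! ### The theorem: equality of spaces from equivalence of functionals -/

theorem mainTheorem6 (p q r : ℝ≥0∞) (hp : 0 < p) (hp_top : p < ∞) (hq : 0 < q) (hq_top : q < ∞)
    (hr : 0 < r) (hr_top : r < ∞) (hr1 : r ≠ 1) (hpq : p = q) (hp1 : p ≤ 1) :
    (r ≤ p → ∃ C : ℝ≥0, ∀ u v w : ℝ → ℝ≥0∞,
      v ∈ CopCes.Weight → u ∈ CopCes.DualOmega r → w ∈ CopCes.Omega q →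
      ∀ ω₁ ω₂ : ℝ → ℝ≥0∞,
        ω₁ = CopCes.opA r r u → ω₂ = (fun x => CopCes.opAStar p p w x * v x) →
        (CopCes.Mult (CopCes.CopOne r u) (CopCes.Ces p q w v)).Same
          (CopCes.Ces (CopCes.conjExp p) ∞ ω₁ ω₂) ∧
        ∀ f ∈ CopCes.MeasPos,
          (CopCes.Mult (CopCes.CopOne r u) (CopCes.Ces p q w v)).qnorm f
            ≤ C * (CopCes.Ces (CopCes.conjExp p) ∞ ω₁ ω₂).qnorm f ∧
          (CopCes.Ces (CopCes.conjExp p) ∞ ω₁ ω₂).qnorm f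
            ≤ C * (CopCes.Mult (CopCes.CopOne r u) (CopCes.Ces p q w v)).qnorm f) ∧
    (p < r → ∃ C : ℝ≥0, ∀ u v w : ℝ → ℝ≥0∞,
      v ∈ CopCes.Weight → u ∈ CopCes.DualOmega r → w ∈ CopCes.Omega q →
      ∀ ω₁ ω₂ : ℝ → ℝ≥0∞,
        ω₁ = CopCes.opA r p u → ω₂ = (fun x => CopCes.opAStar p p w x * v x) →
        (CopCes.lnorm r (Set.Ioi 0) u < ∞ →
          (CopCes.Mult (CopCes.CopOne r u) (CopCes.Ces p q w v)).Same
            ((CopCes.Ces (CopCes.conjExp p) (CopCes.arrow r p) ω₁ ω₂).inter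
              (CopCes.Lp (CopCes.conjExp p) ω₂))) ∧
        (CopCes.lnorm r (Set.Ioi 0) u = ∞ →
          (CopCes.Mult (CopCes.CopOne r u) (CopCes.Ces p q w v)).Same
            (CopCes.Ces (CopCes.conjExp p) (CopCes.arrow r p) ω₁ ω₂)) ∧
        ∀ f ∈ CopCes.MeasPos,
          (CopCes.Mult (CopCes.CopOne r u) (CopCes.Ces p q w v)).qnorm f
            ≤ C * ((CopCes.Ces (CopCes.conjExp p) (CopCes.arrow r p) ω₁ ω₂).qnorm f +
              (CopCes.lnorm r (Set.Ioi 0) u)⁻¹ *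
                CopCes.wnorm (CopCes.conjExp p) ω₂ (Set.Ioi 0) f) ∧
          (CopCes.Ces (CopCes.conjExp p) (CopCes.arrow r p) ω₁ ω₂).qnorm f +
              (CopCes.lnorm r (Set.Ioi 0) u)⁻¹ *
                CopCes.wnorm (CopCes.conjExp p) ω₂ (Set.Ioi 0) f
            ≤ C * (CopCes.Mult (CopCes.CopOne r u) (CopCes.Ces p q w v)).qnorm f) := by
  subst hpq
  have hR : 0 < r.toReal := ENNReal.toReal_pos hr.ne' hr_top.ne
  constructor
  · intro hrp
    obtain ⟨C, hC⟩ := CopCes.exists_mult_equiv_of_le hp hp1 hr hrp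
    refine ⟨C, fun u v w hv hu hw ω₁ ω₂ h₁ h₂ => ?_⟩
    subst h₁ h₂
    exact ⟨.of_le (CopCes.mult_carrier_eq hp hp_top hr hr_top hu hv.1 hw.1) rfl
      ENNReal.coe_ne_top (hC u v w hv hu hw), hC u v w hv hu hw⟩
  · intro hpr
    obtain ⟨C, hC⟩ := CopCes.exists_mult_equiv_of_lt hp hp1 hr_top hpr
    refine ⟨C, fun u v w hv hu hw ω₁ ω₂ h₁ h₂ => ?_⟩
    subst h₁ h₂
    have hcar := CopCes.mult_carrier_eq hp hp_top hr hr_top hu hv.1 hw.1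
    refine ⟨fun hut => ?_, fun hut => ?_, hC u v w hv hu hw⟩
    · have hN0 : CopCes.lnorm r (Ioi 0) u ≠ 0 := by
        refine ((hu.2 1 one_pos).1.trans_le ?_).ne'
        exact eLpNorm_mono_measure _ (Measure.restrict_mono (fun x hx => hx.1) le_rfl)
      set N := CopCes.lnorm r (Ioi 0) u
      -- The intersection carries the plain sum of quasi-norms, without the factor `N⁻¹`. Removing
      -- that factor makes this constant depend on `u`, which `Same` permits for fixed weights.
      have hC' : (C : ℝ≥0∞) * (1 + N⁻¹) + (1 + N) * C ≠ ∞ := by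
        simp [ENNReal.mul_eq_top, hN0, hut.ne]
      refine .of_le hcar ?_ hC' fun f hf => ?_
      · ext f
        constructor
        · exact fun h => ⟨h.1.1, ENNReal.add_lt_top.2 ⟨h.1.2, h.2.2⟩⟩
        · rintro ⟨hf, h⟩
          have h' := ENNReal.add_lt_top.1 h
          exact ⟨⟨hf, h'.1⟩, hf, h'.2⟩
      · have h := hC u v w hv hu hw f hf
        set ω : ℝ → ℝ≥0∞ := fun x => CopCes.opAStar p p w x * v x
        set a := (CopCes.Ces (CopCes.conjExp p) (CopCes.arrow r p) (CopCes.opA r p u) ω).qnorm f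
        set b := CopCes.wnorm (CopCes.conjExp p) ω (Ioi 0) f
        change _ ≤ _ * (a + b) ∧ a + b ≤ _
        constructor
        · refine h.1.trans (le_trans ?_ (mul_le_mul_left le_self_add _))
          rw [mul_assoc]
          gcongr
          calc a + N⁻¹ * b ≤ (1 + N⁻¹) * a + (1 + N⁻¹) * b := by
                gcongr
                · exact le_mul_of_one_le_left' le_self_add
                · exact le_add_self
            _ = _ := (mul_add _ _ _).symm
        · calc a + b = a + N * (N⁻¹ * b) := by
                rw [← mul_assoc, ENNReal.mul_inv_cancel hN0 hut.ne, one_mul]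
            _ ≤ (1 + N) * a + (1 + N) * (N⁻¹ * b) := by
                gcongr
                · exact le_mul_of_one_le_left' le_self_add
                · exact le_add_self
            _ = (1 + N) * (a + N⁻¹ * b) := (mul_add _ _ _).symm
            _ ≤ (1 + N) * (C * (CopCes.Mult (CopCes.CopOne r u)
                  (CopCes.Ces p p w v)).qnorm f) := by gcongr; exact h.2
            _ ≤ _ := by
                rw [← mul_assoc]
                gcongr
                exact le_add_self
    · refine .of_le hcar rfl (C := C) ENNReal.coe_ne_top fun f hf => ?_
      have h := hC u v w hv hu hw f hf
      -- For `‖u‖ = ∞` the end term vanishes even where the `L_{p'}` functional is infinite.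
      rwa [hut, ENNReal.inv_top, zero_mul, add_zero] at h
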